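/- Let $X_1, X_2, \ldots$ be independent identically distributed real random variables, let $X \stackrel{d}{=} X_i$, and let $f_1, \ldots, f_m : \mathbb R \to \mathbb R$ be measurable functions with $\mathbb E[f_i(X)^4] < \infty$ for all $i$, such that the covariance matrix $\mathcal Q = (\mathrm{Cov}(f_i(X), f_j(X)))_{i,j=1}^m$ is nonsingular. For $N \ge 1$ put $\hat m(f) = \frac1N\sum_{i=1}^N f(X_i)$, $\hat s(f) = \bigl(\frac1N\sum_{i=1}^N (f(X_i)-\hat m(f))^2\bigr)^{1/2}$ and, for a lag $0 \le k < N$, $$\hat\gamma_k(f,g) = \frac1{N-k}\sum_{i=1}^{N-k}(f(X_i)-\hat m(f))(g(X_{i+k})-\hat m(g)), \qquad \hat\rho_k(f,g) = \frac{\hat\gamma_k(f,g)}{\hat s(f)\hat s(g)}.$$ Let $\hat{\mathbb Q}_k = [\hat\gamma_k(f_i,f_j)]_{i,j=1}^m$ and $\hat{\mathbb C}_k = [\hat\rho_k(f_i,f_j)]_{i,j=1}^m$, regarded as vectors in $\mathbb R^{m^2}$, and let $\hat{\mathcal Q} = (\hat\gamma_0(f_i,f_j))_{i,j=1}^m$ and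 $\hat{\mathcal C} = (\hat\rho_0(f_i,f_j))_{i,j=1}^m$ be the estimated covariance and correlation matrices. Let $\Phi$ be a continuous map from the set of positive definite symmetric $m\times m$ matrices to $\mathbb R^{m\times m}$ with $\Phi(A)'\Phi(A) = A^{-1}$ for every such $A$, extended to all matrices by an arbitrary Borel measurable convention. Then for every fixed $K$, as $N \to \infty$, in distribution, $$N^{1/2}\,\bigl(\Phi(\hat{\mathcal Q})\otimes\Phi(\hat{\mathcal Q})\bigr)\bigl[\hat{\mathbb Q}_1, \ldots, \hat{\mathbb Q}_K\bigr] \Rightarrow \mathcal N_{m^2K}(\mathbf 0, I_{m^2K}),$$ $$N^{1/2}\,\bigl(\Phi(\hat{\mathcal C})\otimes\Phi(\hat{\mathcal C})\bigr)\bigl[\hat{\mathbb C}_1, \ldots, \hat{\mathbb C}_K\bigr] \Rightarrow \mathcal N_{m^2K}(\mathbf 0, I_{m^2K}),$$ where the $m^2\times m^2$ Kronecker product is applied to each of the $K$ vectors. -/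

import Mathlib

open MeasureTheory ProbabilityTheory Filter
open scoped Kronecker

noncomputable section

namespace IIDTest

variable {Ω : Type*}

/-- The empirical mean `m̂(f) = N⁻¹ ∑ f(X_i)` over the first `N` observations. The observations
are `X 0, X 1, …, X (N - 1)`: the sequence is indexed from `0`. -/
def empMean (X : ℕ → Ω → ℝ) (N : ℕ) (f : ℝ → ℝ) (ω : Ω) : ℝ :=
  (N : ℝ)⁻¹ * ∑ i ∈ Finset.range N, f (X i ω)

/-- The empirical standard deviation `ŝ(f)`, with
`ŝ²(f) = N⁻¹ ∑ (f(X_i) - m̂(f))²`. -/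
def empStd (X : ℕ → Ω → ℝ) (N : ℕ) (f : ℝ → ℝ) (ω : Ω) : ℝ :=
  Real.sqrt ((N : ℝ)⁻¹ * ∑ i ∈ Finset.range N, (f (X i ω) - empMean X N f ω) ^ 2)

/-- The empirical cross-covariance with lag `k`,
`γ̂_k(f, g) = (N - k)⁻¹ ∑_{i = 1}^{N - k} (f(X_i) - m̂(f)) (g(X_{i + k}) - m̂(g))`
(meaningful for `k < N`). -/
def empCov (X : ℕ → Ω → ℝ) (N k : ℕ) (f g : ℝ → ℝ) (ω : Ω) : ℝ :=
  ((N : ℝ) - (k : ℝ))⁻¹ * ∑ i ∈ Finset.range (N - k),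
    (f (X i ω) - empMean X N f ω) * (g (X (i + k) ω) - empMean X N g ω)

/-- The empirical cross-correlation with lag `k`,
`ρ̂_k(f, g) = γ̂_k(f, g) / (ŝ(f) ŝ(g))`. -/
def empCorr (X : ℕ → Ω → ℝ) (N k : ℕ) (f g : ℝ → ℝ) (ω : Ω) : ℝ :=
  empCov X N k f g ω / (empStd X N f ω * empStd X N g ω)

variable {m : ℕ}

/-- The covariance matrix `𝒬 = (Cov(f_i(Y), f_j(Y)))` of the random vector
`(f_1(Y), …, f_m(Y))`. -/
def covMatrix [MeasurableSpace Ω] (P : Measure Ω) (Y : Ω → ℝ) (f : Fin m → ℝ → ℝ) :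
    Matrix (Fin m) (Fin m) ℝ :=
  Matrix.of fun i j => cov[fun ω => f i (Y ω), fun ω => f j (Y ω); P]

/-- The estimated covariance matrix `𝒬̂ = (γ̂_0(f_i, f_j))`. -/
def empCovMatrix (X : ℕ → Ω → ℝ) (N : ℕ) (f : Fin m → ℝ → ℝ) (ω : Ω) :
    Matrix (Fin m) (Fin m) ℝ :=
  Matrix.of fun i j => empCov X N 0 (f i) (f j) ω

/-- The estimated correlation matrix `𝒞̂ = (ρ̂_0(f_i, f_j))`. -/
def empCorrMatrix (X : ℕ → Ω → ℝ) (N : ℕ) (f : Fin m → ℝ → ℝ) (ω : Ω) :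
    Matrix (Fin m) (Fin m) ℝ :=
  Matrix.of fun i j => empCorr X N 0 (f i) (f j) ω

/-- The vector `ℚ̂_k = [γ̂_k(f_i, f_j)]` in `ℝ^{m²}`. -/
def empCovVec (X : ℕ → Ω → ℝ) (N k : ℕ) (f : Fin m → ℝ → ℝ) (ω : Ω) : Fin m × Fin m → ℝ :=
  fun p => empCov X N k (f p.1) (f p.2) ω

/-- The vector `ℂ̂_k = [ρ̂_k(f_i, f_j)]` in `ℝ^{m²}`. -/
def empCorrVec (X : ℕ → Ω → ℝ) (N k : ℕ) (f : Fin m → ℝ → ℝ) (ω : Ω) : Fin m × Fin m → ℝ :=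
  fun p => empCorr X N k (f p.1) (f p.2) ω

/-- Given a matrix `B` and vectors `v_1, …, v_K` in `ℝ^{m²}`, the vector
`N^{1/2} (B ⊗ B) [v_1, …, v_K]` in `ℝ^{m² K}`: the `m² × m²` matrix `B ⊗ B` is applied to each of
the `K` blocks. The block with index `k : Fin K` is `v (k + 1)`, since the lags run from `1` to
`K`. -/
def whiten (K N : ℕ) (B : Matrix (Fin m) (Fin m) ℝ) (v : ℕ → Fin m × Fin m → ℝ) :
    EuclideanSpace ℝ (Fin K × Fin m × Fin m) :=
  WithLp.toLp 2 fun p => Real.sqrt (N : ℝ) * ((B ⊗ₖ B).mulVec (v ((p.1 : ℕ) + 1))) p.2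

end IIDTest

end

/-! Let `B₀` satisfy `B₀ᵀ B₀ = 𝒬⁻¹`. The functions `h = B₀ (f - E f)` are then centred and
orthonormal in L², so by independence the products `h_a(X_i) h_b(X_{i+k})` with `k = 1, …, K` are
centred and orthonormal over all `(i, k, a, b)`. Any linear combination over `(k, a, b)` is white
noise in `i` and depends only on `X_i, …, X_{i+K}`. The CLT for such noise
(`tendsto_charFun_orthogonal_finiteRange`, by Bernstein blocks separated by gaps of length `K`) and
Cramér–Wold give the standard Gaussian limit in `tendstoInDistribution_lagged_products`.

Replacing true means by empirical ones costs `o(1)` in L¹ (`tendsto_integral_abs_empCov_sub`).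
Undoing the change of basis, the scaled lagged covariances converge to `(B₀⁻¹ ⊗ B₀⁻¹) 𝒩(0, I)`. By
Slutsky, any matrices `B_N → B₀` a.s. whiten them (`tendstoInDistribution_whiten`).

Both claims are instances. For covariances, `B_N = Φ(𝒬̂) → Φ(𝒬)` by the strong law and continuity.
For correlations, `𝒞̂ = D̂ 𝒬̂ D̂` with `D̂ = diag(1/ŝ)`, and the scaling moves into the whitening
matrix: `B_N = Φ(𝒞̂) D̂` tends to `Φ(D𝒬D) D`, again a square root of `𝒬⁻¹`. -/

/-! ### Blocks, orthogonal noise and L² comparison of characteristic functions. -/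

section Blocking

open Finset

/-- Grouping a countable independent family into blocks yields an independent family of tuples. -/
lemma ProbabilityTheory.iIndepFun.curry_blocks {Ω ι κ E : Type*} [MeasurableSpace Ω]
    [MeasurableSpace E] {P : Measure Ω} [IsProbabilityMeasure P] [Countable ι] [Countable κ]
    {X : ι × κ → Ω → E} (hX : ∀ p, AEMeasurable (X p) P) (h : iIndepFun X P) :
    iIndepFun (fun i ω (k : κ) => X (i, k) ω) P := by
  have hpr : ∀ i k, IsProbabilityMeasure (P.map (X (i, k))) := fun i k =>
    Measure.isProbabilityMeasure_map (hX _)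
  have hrow : ∀ i, iIndepFun (fun k => X (i, k)) P := fun i =>
    h.precomp (g := fun k => (i, k)) fun a b hab => by simpa using hab
  rw [iIndepFun_iff_map_fun_eq_infinitePi_map₀' fun i => aemeasurable_pi_lambda _ fun k => hX _]
  have hprod := (iIndepFun_iff_map_fun_eq_infinitePi_map₀' hX).1 h
  have hrow' : (fun i => P.map (fun ω (k : κ) => X (i, k) ω)) =
      fun i => Measure.infinitePi fun k => P.map (X (i, k)) := by
    funext i
    exact (iIndepFun_iff_map_fun_eq_infinitePi_map₀' fun k => hX _).1 (hrow i)
  rw [hrow', ← Measure.infinitePi_map_curry (fun i k => P.map (X (i, k))), ← hprod,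
    AEMeasurable.map_map_of_aemeasurable (by fun_prop) (aemeasurable_pi_lambda _ hX)]
  rfl

lemma sq_integral_abs_le {Ω : Type*} [MeasurableSpace Ω] {P : Measure Ω} [IsProbabilityMeasure P]
    {A : Ω → ℝ} (hA : MemLp A 2 P) : (∫ ω, |A ω| ∂P) ^ 2 ≤ ∫ ω, A ω ^ 2 ∂P := by
  have h := variance_nonneg |A| P
  rw [variance_eq_sub hA.abs] at h
  simpa using h

lemma integral_abs_le_sqrt {Ω : Type*} [MeasurableSpace Ω] {P : Measure Ω}
    [IsProbabilityMeasure P] {A : Ω → ℝ} (hA : MemLp A 2 P) :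
    ∫ ω, |A ω| ∂P ≤ √(∫ ω, A ω ^ 2 ∂P) :=
  Real.le_sqrt_of_sq_le (sq_integral_abs_le hA)

/-- From `|e^{ia} - e^{ib}| ≤ |a - b|`: L¹ closeness transfers to characteristic functions. -/
lemma norm_charFun_sub_le {Ω : Type*} [MeasurableSpace Ω] {P : Measure Ω}
    [IsProbabilityMeasure P] {A B : Ω → ℝ} (hA : AEMeasurable A P) (hB : AEMeasurable B P)
    (hAB : Integrable (fun ω => A ω - B ω) P) :
    ‖charFun (P.map A) 1 - charFun (P.map B) 1‖ ≤ ∫ ω, |A ω - B ω| ∂P := by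
  have hI : ∀ {C : Ω → ℝ}, AEMeasurable C P →
      Integrable (fun ω => Complex.exp (C ω * Complex.I)) P := fun {C} hC => by
    refine Integrable.of_bound (C := 1) (by fun_prop) (ae_of_all _ fun ω => ?_)
    simp [Complex.norm_exp_ofReal_mul_I]
  rw [charFun_apply_real, charFun_apply_real, integral_map hA (by fun_prop),
    integral_map hB (by fun_prop)]
  simp only [Complex.ofReal_one, one_mul]
  rw [← integral_sub (hI hA) (hI hB)]
  refine (norm_integral_le_integral_norm _).trans
    (integral_mono ((hI hA).sub (hI hB)).norm hAB.abs fun ω => ?_)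
  have h1 : Complex.exp (A ω * Complex.I) - Complex.exp (B ω * Complex.I) =
      Complex.exp (B ω * Complex.I) * (Complex.exp (Complex.I * ((A ω - B ω : ℝ) : ℂ)) - 1) := by
    rw [mul_sub, ← Complex.exp_add, mul_one]
    congr 2
    push_cast
    ring
  simp only [h1, norm_mul, Complex.norm_exp_ofReal_mul_I, one_mul]
  exact (Real.norm_exp_I_mul_ofReal_sub_one_le).trans_eq (Real.norm_eq_abs _)

/-- The white noise property: `Z` is a square integrable orthogonal sequence with `E Z_i² = v`. -/
structure IsOrthogonalNoise {Ω : Type*} [MeasurableSpace Ω] (P : Measure Ω) (Z : ℕ → Ω → ℝ)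
    (v : ℝ) : Prop where
  memLp : ∀ i, MemLp (Z i) 2 P
  integral_mul : ∀ i j, ∫ ω, Z i ω * Z j ω ∂P = if i = j then v else 0

namespace IsOrthogonalNoise

variable {Ω : Type*} [MeasurableSpace Ω] {P : Measure Ω} {Z : ℕ → Ω → ℝ} {v : ℝ}

lemma memLp_sum (h : IsOrthogonalNoise P Z v) (s : Finset ℕ) :
    MemLp (fun ω => ∑ i ∈ s, Z i ω) 2 P :=
  memLp_finsetSum _ fun i _ => h.memLp i

lemma integral_sum_mul_sum (h : IsOrthogonalNoise P Z v) (r s : Finset ℕ) :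
    ∫ ω, (∑ i ∈ r, Z i ω) * (∑ j ∈ s, Z j ω) ∂P = v * (#(r ∩ s) : ℝ) := by
  have hI : ∀ i j, Integrable (fun ω => Z i ω * Z j ω) P := fun i j =>
    (h.memLp i).integrable_mul (h.memLp j)
  simp only [sum_mul_sum]
  rw [integral_finsetSum _ fun i _ => integrable_finsetSum _ fun j _ => hI i j]
  simp_rw [integral_finsetSum s fun j _ => hI _ j, h.integral_mul]
  simp [Finset.sum_ite_mem, mul_comm]

lemma integral_sum_sq (h : IsOrthogonalNoise P Z v) (s : Finset ℕ) :
    ∫ ω, (∑ i ∈ s, Z i ω) ^ 2 ∂P = v * (#s : ℝ) := by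
  simp_rw [sq, h.integral_sum_mul_sum, inter_self]

lemma nonneg (h : IsOrthogonalNoise P Z v) : 0 ≤ v := by
  have := h.integral_mul 0 0
  rw [if_pos rfl] at this
  rw [← this]
  exact integral_nonneg fun ω => mul_self_nonneg _

/-- By orthogonality the cross term sees only `r ∩ s = s`. This gives exact L² errors both for
discarding the gaps between blocks and for truncating a sum at `N - k`. -/
lemma integral_sub_sq (h : IsOrthogonalNoise P Z v) {r s : Finset ℕ} (hsr : s ⊆ r) (a b : ℝ) :
    ∫ ω, (a * ∑ i ∈ r, Z i ω - b * ∑ i ∈ s, Z i ω) ^ 2 ∂P =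
      v * (a ^ 2 * #r - 2 * a * b * #s + b ^ 2 * #s) := by
  have h1 : ∀ ω, (a * ∑ i ∈ r, Z i ω - b * ∑ i ∈ s, Z i ω) ^ 2 =
      a ^ 2 * ((∑ i ∈ r, Z i ω) * ∑ i ∈ r, Z i ω)
      - 2 * a * b * ((∑ i ∈ r, Z i ω) * ∑ i ∈ s, Z i ω)
      + b ^ 2 * ((∑ i ∈ s, Z i ω) * ∑ i ∈ s, Z i ω) := fun ω => by ring
  have hI : ∀ r s : Finset ℕ, Integrable (fun ω => (∑ i ∈ r, Z i ω) * ∑ i ∈ s, Z i ω) P :=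
    fun r s => (h.memLp_sum r).integrable_mul (h.memLp_sum s)
  simp_rw [h1]
  rw [integral_add (Integrable.sub' ((hI _ _).const_mul _) ((hI _ _).const_mul _))
      ((hI _ _).const_mul _),
    integral_sub ((hI _ _).const_mul _) ((hI _ _).const_mul _)]
  simp_rw [integral_const_mul, h.integral_sum_mul_sum, inter_self, inter_eq_right.2 hsr]
  ring

end IsOrthogonalNoise

lemma tendsto_of_norm_sub_le_approx {φ : ℕ → ℂ} {c : ℂ} {b : ℕ → ℕ → ℝ} {β : ℕ → ℝ}
    (h : ∀ L, ∀ᶠ N in atTop, ‖φ N - c‖ ≤ b L N)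
    (hb : ∀ L, Tendsto (b L) atTop (nhds (β L))) (hβ : Tendsto β atTop (nhds 0)) :
    Tendsto φ atTop (nhds c) := by
  rw [Metric.tendsto_nhds]
  intro ε hε
  obtain ⟨L, hL⟩ := (hβ.eventually_lt_const hε).exists
  filter_upwards [h L, (hb L).eventually_lt_const hL] with N h1 h2
  rw [dist_eq_norm]
  exact h1.trans_lt h2

/-- Division with remainder by `M` makes the indexing injective. Writing the blocks as one `Finset`
sum makes the second moment formulas for noise applicable. -/
lemma sum_range_sum_range_eq_sum_image (n L M : ℕ) (hLM : L ≤ M) (z : ℕ → ℝ) :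
    ∑ j ∈ range n, ∑ l ∈ range L, z (j * M + l) =
        ∑ i ∈ (range n ×ˢ range L).image (fun p => p.1 * M + p.2), z i ∧
      #((range n ×ˢ range L).image (fun p => p.1 * M + p.2)) = n * L := by
  have hinj : Set.InjOn (fun p : ℕ × ℕ => p.1 * M + p.2) (range n ×ˢ range L : Finset (ℕ × ℕ)) := by
    rintro ⟨a, b⟩ hab ⟨c, d⟩ hcd h
    simp only [coe_product, coe_range, Set.mem_prod, Set.mem_Iio] at hab hcd h
    have hb : b < M := by omega
    have hd : d < M := by omega
    have h1 : b = d := by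
      have := congrArg (· % M) h
      simpa [Nat.add_mod, Nat.mod_eq_of_lt hb, Nat.mod_eq_of_lt hd] using this
    subst h1
    have hM : 0 < M := by omega
    simp only [add_left_inj] at h
    rw [Nat.eq_of_mul_eq_mul_right hM h]
  constructor
  · rw [sum_image hinj, sum_product]
  · rw [card_image_of_injOn hinj, card_product, card_range, card_range]

lemma tendsto_natDiv_mul_div (M : ℕ) (hM : 0 < M) :
    Tendsto (fun N : ℕ => ((N / M : ℕ) * M : ℝ) / N) atTop (nhds 1) := by
  have h1 : Tendsto (fun N : ℕ => 1 - (M : ℝ) / N) atTop (nhds (1 - 0)) :=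
    tendsto_const_nhds.sub (tendsto_const_div_atTop_nhds_zero_nat _)
  rw [sub_zero] at h1
  refine tendsto_of_tendsto_of_tendsto_of_le_of_le' h1 tendsto_const_nhds ?_ ?_
  · filter_upwards [eventually_gt_atTop 0] with N hN
    have hN' : (0 : ℝ) < N := by exact_mod_cast hN
    rw [le_div_iff₀ hN', sub_mul, one_mul, div_mul_cancel₀ _ hN'.ne']
    have := Nat.div_add_mod N M
    have h2 := Nat.mod_lt N hM
    have h3 : N ≤ (N / M) * M + M := by nlinarith
    have h4 : (N : ℝ) ≤ (N / M : ℕ) * M + M := by exact_mod_cast h3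
    linarith
  · filter_upwards [eventually_gt_atTop 0] with N hN
    have hN' : (0 : ℝ) < N := by exact_mod_cast hN
    rw [div_le_one hN']
    exact_mod_cast Nat.div_mul_le_self N M

end Blocking

/-! ### Central limit theorem for finite range white noise. -/

section BlockCLT

open Finset

variable {Ω : Type*} [MeasurableSpace Ω] {P : Measure Ω} [IsProbabilityMeasure P]

/-- The sums of a finite range process over blocks that are separated by gaps longer than
the range are independent and identically distributed. -/
lemma blockSum_iid {X : ℕ → Ω → ℝ} (hindep : iIndepFun X P)
    (hident : ∀ n, IdentDistrib (X n) (X 0) P P) {K : ℕ} {G : (Fin (K + 1) → ℝ) → ℝ}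
    (hG : Measurable G) {Z : ℕ → Ω → ℝ} (hZ : ∀ i ω, Z i ω = G fun r => X (i + r) ω) (L : ℕ) :
    iIndepFun (fun j ω => ∑ l ∈ range L, Z (j * (L + K) + l) ω) P ∧
    ∀ j, IdentDistrib (fun ω => ∑ l ∈ range L, Z (j * (L + K) + l) ω)
      (fun ω => ∑ l ∈ range L, Z (0 * (L + K) + l) ω) P P := by
  have hX : ∀ n, AEMeasurable (X n) P := fun n => (hident n).aemeasurable_fst
  -- `L` consecutive windows of length `K + 1` read exactly `L + K` inputs, so blocks at stride `L +
  -- K` read disjoint inputs.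
  let F : (Fin (L + K) → ℝ) → ℝ := fun x =>
    ∑ l : Fin L, G fun r : Fin (K + 1) => x ⟨l + r, by omega⟩
  have hF : Measurable F := by
    refine Finset.measurable_fun_sum _ fun l _ => hG.comp ?_
    exact measurable_pi_lambda _ fun r => measurable_pi_apply _
  have hY : ∀ j, (fun ω => ∑ l ∈ range L, Z (j * (L + K) + l) ω) =
      F ∘ fun ω (k : Fin (L + K)) => X (j * (L + K) + k) ω := by
    intro j
    funext ω
    simp only [Function.comp, F, hZ, add_assoc]
    exact (Fin.sum_univ_eq_sum_range
      (fun l => G fun r : Fin (K + 1) => X (j * (L + K) + (l + r)) ω) L).symm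
  have hinj : Function.Injective fun p : ℕ × Fin (L + K) => p.1 * (L + K) + (p.2 : ℕ) := by
    rintro ⟨a, b⟩ ⟨c, d⟩ h
    simp only at h
    have h1 : (b : ℕ) = d := by
      have := congrArg (· % (L + K)) h
      simpa [Nat.add_mod, Nat.mod_eq_of_lt b.2, Nat.mod_eq_of_lt d.2] using this
    have hM : 0 < L + K := by have := b.2; omega
    rw [h1, add_left_inj] at h
    rw [Nat.eq_of_mul_eq_mul_right hM h, Fin.ext h1]
  have hblocks := ProbabilityTheory.iIndepFun.curry_blocks (P := P)
    (X := fun p : ℕ × Fin (L + K) => X (p.1 * (L + K) + (p.2 : ℕ))) (fun p => hX _)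
    (hindep.precomp hinj)
  refine ⟨?_, fun j => ?_⟩
  · have h := hblocks.comp (fun _ => F) fun _ => hF
    rwa [← funext hY] at h
  rw [hY, hY]
  refine IdentDistrib.comp ?_ hF
  have hrow : ∀ j, iIndepFun (fun k : Fin (L + K) => X (j * (L + K) + k)) P := fun j =>
    hindep.precomp (g := fun k : Fin (L + K) => j * (L + K) + (k : ℕ)) fun a b hab => by
      simpa [Fin.ext_iff] using hab
  exact IdentDistrib.pi (fun k => (hident _).trans (hident _).symm) (hrow j) (hrow 0)

lemma tendsto_charFun_mul_inv_sqrt_mul_sum {Y : ℕ → Ω → ℝ} (hindep : iIndepFun Y P)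
    (hident : ∀ n, IdentDistrib (Y n) (Y 0) P P) (hY : MemLp (Y 0) 2 P)
    (hmean : ∫ ω, Y 0 ω ∂P = 0) (t : ℝ) :
    Tendsto (fun n : ℕ => charFun (P.map fun ω => t * ((√n)⁻¹ * ∑ j ∈ range n, Y j ω)) 1) atTop
      (nhds (Complex.exp (-((∫ ω, Y 0 ω ^ 2 ∂P) * t ^ 2 / 2 : ℝ)))) := by
  have hvar : Var[Y 0; P] = ∫ ω, Y 0 ω ^ 2 ∂P :=
    variance_of_integral_eq_zero hY.aestronglyMeasurable.aemeasurable hmean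
  have hclt := tendstoInDistribution_inv_sqrt_mul_sum_sub
    (P' := gaussianReal 0 (Var[Y 0; P]).toNNReal) (Y := id) HasLaw.id hY hindep hident
  have h1 := ProbabilityMeasure.tendsto_iff_tendsto_charFun.1 hclt.tendsto t
  simp only [ProbabilityMeasure.coe_mk, Measure.map_id, charFun_gaussianReal, hmean] at h1
  have hv : (((Var[Y 0; P]).toNNReal : ℝ) : ℂ) = ((∫ ω, Y 0 ω ^ 2 ∂P : ℝ) : ℂ) := by
    rw [Real.coe_toNNReal _ (variance_nonneg _ _), hvar]
  rw [hv] at h1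
  have hlim : Complex.exp (-((∫ ω, Y 0 ω ^ 2 ∂P) * t ^ 2 / 2 : ℝ)) = Complex.exp
      (t * (0 : ℝ) * Complex.I - ((∫ ω, Y 0 ω ^ 2 ∂P : ℝ) : ℂ) * t ^ 2 / 2) := by
    push_cast
    congr 1
    ring
  rw [hlim]
  refine h1.congr fun n => ?_
  have hm : AEMeasurable (fun ω => (√n)⁻¹ * ∑ j ∈ range n, Y j ω) P :=
    (Finset.aemeasurable_fun_sum _ fun j _ => (hident j).aemeasurable_fst).const_mul _
  rw [charFun_map_mul_comp hm, mul_one]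
  simp

/-- The i.i.d. CLT applies to the block sums, and orthogonality makes the variance of one block
exactly `v * L`. -/
lemma tendsto_charFun_blockSum {X : ℕ → Ω → ℝ} (hindep : iIndepFun X P)
    (hident : ∀ n, IdentDistrib (X n) (X 0) P P) {K : ℕ} {G : (Fin (K + 1) → ℝ) → ℝ}
    (hG : Measurable G) {Z : ℕ → Ω → ℝ} (hZ : ∀ i ω, Z i ω = G fun r => X (i + r) ω) {v : ℝ}
    (hnoise : IsOrthogonalNoise P Z v) (hmean : ∀ i, ∫ ω, Z i ω ∂P = 0) (L : ℕ) (t : ℝ) :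
    Tendsto (fun n : ℕ => charFun (P.map fun ω =>
        t * ((√n)⁻¹ * ∑ j ∈ range n, ∑ l ∈ range L, Z (j * (L + K) + l) ω)) 1) atTop
      (nhds (Complex.exp (-(v * L * t ^ 2 / 2 : ℝ)))) := by
  obtain ⟨hind, hid⟩ := blockSum_iid hindep hident hG hZ L
  have hsum : ∀ ω, ∑ l ∈ range L, Z (0 * (L + K) + l) ω = ∑ i ∈ range L, Z i ω := by simp
  have hLp : MemLp (fun ω => ∑ l ∈ range L, Z (0 * (L + K) + l) ω) 2 P := by
    simp_rw [hsum]
    exact hnoise.memLp_sum _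
  have hmean0 : ∫ ω, ∑ l ∈ range L, Z (0 * (L + K) + l) ω ∂P = 0 := by
    rw [integral_finsetSum _ fun l _ => (hnoise.memLp _).integrable (by norm_num)]
    simp [hmean]
  have h := tendsto_charFun_mul_inv_sqrt_mul_sum hind hid hLp hmean0 t
  simp_rw [hsum, hnoise.integral_sum_sq, card_range] at h
  exact h

/-- **Central limit theorem** for an orthogonal sequence of the form
`Z_i = G(X_i, …, X_{i + K})`, where the `X_i` are independent and identically distributed. -/
theorem tendsto_charFun_orthogonal_finiteRange {X : ℕ → Ω → ℝ} (hindep : iIndepFun X P)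
    (hident : ∀ n, IdentDistrib (X n) (X 0) P P) {K : ℕ} {G : (Fin (K + 1) → ℝ) → ℝ}
    (hG : Measurable G) {Z : ℕ → Ω → ℝ} (hZ : ∀ i ω, Z i ω = G fun r => X (i + r) ω) {v : ℝ}
    (hnoise : IsOrthogonalNoise P Z v) (hmean : ∀ i, ∫ ω, Z i ω ∂P = 0) :
    Tendsto (fun N : ℕ => charFun (P.map fun ω => (√N)⁻¹ * ∑ i ∈ range N, Z i ω) 1) atTop
      (nhds (Complex.exp (-(v / 2 : ℝ)))) := by
  -- With `n = N / (L + K)` blocks the two factors multiply to about `1 / √N`; `q L` below is the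
  -- proportion of indices that survive removal of the gaps.
  let ψ : ℕ → ℕ → ℂ := fun L n => charFun (P.map fun ω =>
    (√((L + K : ℕ) : ℝ))⁻¹ * ((√n)⁻¹ * ∑ j ∈ range n, ∑ l ∈ range L, Z (j * (L + K) + l) ω)) 1
  let q : ℕ → ℝ := fun L => (L : ℝ) / (L + K : ℕ)
  have hψ : ∀ L, Tendsto (fun N => ψ (L + 1) (N / (L + 1 + K))) atTop
      (nhds (Complex.exp (-(q (L + 1) * v / 2 : ℝ)))) := by
    intro L
    have := (tendsto_charFun_blockSum hindep hident hG hZ hnoise hmean (L + 1)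
      (√((L + 1 + K : ℕ) : ℝ))⁻¹).comp
      (Nat.tendsto_div_const_atTop (show L + 1 + K ≠ 0 by omega))
    have hq : v * (L + 1 : ℕ) * (√((L + 1 + K : ℕ) : ℝ))⁻¹ ^ 2 / 2 = q (L + 1) * v / 2 := by
      rw [inv_pow, Real.sq_sqrt (Nat.cast_nonneg _)]
      simp only [q]
      ring
    rw [hq] at this
    exact this
  -- The right side is the exact L² distance between the full and the blocked sum. The shift to `L +
  -- 1` keeps the stride positive even when `K = 0`.
  have hbound : ∀ L, ∀ᶠ N : ℕ in atTop,
      ‖charFun (P.map fun ω => (√N)⁻¹ * ∑ i ∈ range N, Z i ω) 1 - ψ (L + 1) (N / (L + 1 + K))‖ ≤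
        √(v * (1 + q (L + 1) - 2 * q (L + 1) *
          √(((N / (L + 1 + K) : ℕ) * (L + 1 + K : ℕ) : ℝ) / N))) := by
    intro L
    set M := L + 1 + K with hM
    filter_upwards [eventually_ge_atTop M] with N hN
    set n := N / M with hn
    have hMpos : 0 < M := by omega
    have hnpos : 0 < n := Nat.div_pos hN hMpos
    have hNpos : 0 < N := by omega
    set s := (range n ×ˢ range (L + 1)).image (fun p => p.1 * M + p.2) with hs
    have hS := fun ω => sum_range_sum_range_eq_sum_image n (L + 1) M (by omega) fun i => Z i ω
    have hsN : s ⊆ range N := by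
      intro i hi
      obtain ⟨⟨a, b⟩, hab, rfl⟩ := mem_image.1 hi
      simp only [mem_product, mem_range] at hab ⊢
      have h1 : (a + 1) * M ≤ N :=
        (Nat.mul_le_mul_right M (by omega : a + 1 ≤ n)).trans (Nat.div_mul_le_self N M)
      have h2 : (a + 1) * M = a * M + M := by ring
      omega
    have hA : MemLp (fun ω => (√N)⁻¹ * ∑ i ∈ range N, Z i ω) 2 P :=
      (hnoise.memLp_sum _).const_mul _
    have hB : MemLp (fun ω => ((√(M : ℝ))⁻¹ * (√n)⁻¹) * ∑ i ∈ s, Z i ω) 2 P :=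
      (hnoise.memLp_sum _).const_mul _
    have hψB : ψ (L + 1) n =
        charFun (P.map fun ω => ((√(M : ℝ))⁻¹ * (√n)⁻¹) * ∑ i ∈ s, Z i ω) 1 := by
      have : ∀ ω, ((√(M : ℝ))⁻¹ * (√n)⁻¹) * ∑ i ∈ s, Z i ω =
          (√(M : ℝ))⁻¹ * ((√n)⁻¹ * ∑ j ∈ range n, ∑ l ∈ range (L + 1), Z (j * M + l) ω) :=
        fun ω => by rw [(hS ω).1, mul_assoc]
      simp_rw [this]
      rfl
    rw [hψB]
    refine (norm_charFun_sub_le hA.aestronglyMeasurable.aemeasurable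
      hB.aestronglyMeasurable.aemeasurable ((hA.sub hB).integrable (by norm_num))).trans ?_
    refine (integral_abs_le_sqrt (hA.sub hB)).trans (Real.sqrt_le_sqrt (le_of_eq ?_))
    have hcard : #s = n * (L + 1) := by
      obtain ⟨ω⟩ := nonempty_of_isProbabilityMeasure P
      exact (hS ω).2
    simp only [Pi.sub_apply]
    rw [hnoise.integral_sub_sq hsN, hcard, card_range]
    have hNr : (0 : ℝ) < N := by exact_mod_cast hNpos
    have hnr : (0 : ℝ) < n := by exact_mod_cast hnpos
    have hMr : (0 : ℝ) < M := by exact_mod_cast hMpos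
    rw [Real.sqrt_div (by positivity), Real.sqrt_mul (by positivity)]
    have eN := Real.sq_sqrt hNr.le
    have en := Real.sq_sqrt hnr.le
    have eM := Real.sq_sqrt hMr.le
    have pN := Real.sqrt_pos.2 hNr
    have pn := Real.sqrt_pos.2 hnr
    have pM := Real.sqrt_pos.2 hMr
    have hq : q (L + 1) = ((L + 1 : ℕ) : ℝ) / (√(M : ℝ)) ^ 2 := by rw [eM]
    rw [hq, Nat.cast_mul]
    congr 1
    generalize √(N : ℝ) = x at *
    generalize √(n : ℝ) = y at *
    generalize √(M : ℝ) = z at *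
    rw [← eN, ← en]
    field_simp
    ring
  have hlim : ∀ L, Tendsto (fun N : ℕ => √(v * (1 + q (L + 1) - 2 * q (L + 1) *
      √(((N / (L + 1 + K) : ℕ) * (L + 1 + K : ℕ) : ℝ) / N))) +
      ‖ψ (L + 1) (N / (L + 1 + K)) - Complex.exp (-(v / 2 : ℝ))‖) atTop
      (nhds (√(v * (1 + q (L + 1) - 2 * q (L + 1) * √1)) +
        ‖Complex.exp (-(q (L + 1) * v / 2 : ℝ)) - Complex.exp (-(v / 2 : ℝ))‖)) := by
    intro L
    refine Tendsto.add ?_ ((hψ L).sub_const _).norm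
    have h1 := (Real.continuous_sqrt.tendsto 1).comp
      (tendsto_natDiv_mul_div (L + 1 + K) (by omega))
    exact (Real.continuous_sqrt.tendsto _).comp
      ((tendsto_const_nhds.sub (h1.const_mul _)).const_mul _)
  -- For fixed `L` the limiting L² error is `√(v (1 - q))`, not zero; it vanishes only as `L → ∞`,
  -- where `q → 1`.
  refine tendsto_of_norm_sub_le_approx (fun L => ?_) hlim ?_
  · filter_upwards [hbound L] with N hN
    exact (norm_sub_le_norm_sub_add_norm_sub _ _ _).trans (add_le_add_left hN _)
  · have hq : Tendsto (fun L => q (L + 1)) atTop (nhds 1) := by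
      have h := (tendsto_natCast_div_add_atTop (𝕜 := ℝ) (K : ℝ)).comp (tendsto_add_atTop_nat 1)
      refine h.congr fun L => ?_
      simp [q]
    have hc : Continuous fun x : ℝ => √(v * (1 + x - 2 * x * √1)) +
        ‖Complex.exp (-(x * v / 2 : ℝ)) - Complex.exp (-(v / 2 : ℝ))‖ := by fun_prop
    have := (hc.tendsto 1).comp hq
    convert! this using 2
    norm_num

end BlockCLT

/-! ### Orthogonality and joint normality of lagged products. -/

section LaggedProducts

open Finset

variable {Ω : Type*} [MeasurableSpace Ω] {P : Measure Ω}

lemma ProbabilityTheory.iIndepFun.integral_mul_eq_zero {X : ℕ → Ω → ℝ} (hindep : iIndepFun X P)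
    (hX : ∀ n, AEMeasurable (X n) P) {S : Finset ℕ} {k : ℕ} (hk : k ∉ S) {φ : (S → ℝ) → ℝ}
    (hφ : Measurable φ) {u : ℝ → ℝ} (hu : Measurable u) (hu0 : ∫ ω, u (X k ω) ∂P = 0) :
    ∫ ω, φ (fun i => X i ω) * u (X k ω) ∂P = 0 := by
  have h := (hindep.indepFun_finset₀ S {k} (disjoint_singleton_right.2 hk) hX).comp hφ
    (hu.comp (measurable_pi_apply (⟨k, mem_singleton_self k⟩ : ({k} : Finset ℕ))))
  have h1 : AEStronglyMeasurable (φ ∘ fun ω (i : S) => X i ω) P :=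
    (hφ.comp_aemeasurable (aemeasurable_pi_lambda _ fun i => hX i)).aestronglyMeasurable
  have h2 : AEStronglyMeasurable (fun ω => u (X k ω)) P :=
    (hu.comp_aemeasurable (hX k)).aestronglyMeasurable
  have h3 := h.integral_fun_mul_eq_mul_integral h1 h2
  simp only [Function.comp, hu0, mul_zero] at h3
  exact h3

variable {X : ℕ → Ω → ℝ}

variable (hindep : iIndepFun X P) (hident : ∀ n, IdentDistrib (X n) (X 0) P P)

include hident in
lemma integral_comp_eq {u : ℝ → ℝ} (hu : Measurable u) (n : ℕ) :
    ∫ ω, u (X n ω) ∂P = ∫ ω, u (X 0 ω) ∂P :=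
  ((hident n).comp hu).integral_eq

include hident in
lemma memLp_comp {u : ℝ → ℝ} (hu : Measurable u) {p : ENNReal}
    (h : MemLp (fun ω => u (X 0 ω)) p P) (n : ℕ) : MemLp (fun ω => u (X n ω)) p P :=
  ((hident n).comp hu).memLp_iff.2 h

include hindep hident in
-- At distinct times the second moment of the product factors, so L² factors suffice.
lemma memLp_mul_of_ne {u v : ℝ → ℝ} (hu : Measurable u) (hv : Measurable v)
    (hu2 : MemLp (fun ω => u (X 0 ω)) 2 P) (hv2 : MemLp (fun ω => v (X 0 ω)) 2 P) {i j : ℕ}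
    (hij : i ≠ j) : MemLp (fun ω => u (X i ω) * v (X j ω)) 2 P := by
  have hX : ∀ n, AEMeasurable (X n) P := fun n => (hident n).aemeasurable_fst
  have hu' := memLp_comp hident hu hu2 i
  have hv' := memLp_comp hident hv hv2 j
  refine (memLp_two_iff_integrable_sq
    (hu'.aestronglyMeasurable.mul hv'.aestronglyMeasurable)).2 ?_
  have h := ((hindep.indepFun hij).comp (hu.pow_const 2) (hv.pow_const 2)).integrable_mul
    hu'.integrable_sq hv'.integrable_sq
  refine h.congr (ae_of_all _ fun ω => ?_)
  simp [mul_pow]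

include hindep hident in
-- Unless the index pairs agree, some index occurs exactly once and its centred factor kills the
-- integral: the larger of `p`, `q` if they differ, and otherwise `i`. The factor `u₃` is never the
-- one isolated, so it need not be centred.
lemma integral_lagged_mul_lagged {u₁ u₂ u₃ u₄ : ℝ → ℝ} (h₁ : Measurable u₁) (h₂ : Measurable u₂)
    (h₃ : Measurable u₃) (h₄ : Measurable u₄) (z₁ : ∫ ω, u₁ (X 0 ω) ∂P = 0)
    (z₂ : ∫ ω, u₂ (X 0 ω) ∂P = 0) (z₄ : ∫ ω, u₄ (X 0 ω) ∂P = 0)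
    {i p j q : ℕ} (hip : i < p) (hjq : j < q) :
    ∫ ω, (u₁ (X i ω) * u₂ (X p ω)) * (u₃ (X j ω) * u₄ (X q ω)) ∂P =
      if i = j ∧ p = q then
        (∫ ω, u₁ (X 0 ω) * u₃ (X 0 ω) ∂P) * ∫ ω, u₂ (X 0 ω) * u₄ (X 0 ω) ∂P else 0 := by
  have hX : ∀ n, AEMeasurable (X n) P := fun n => (hident n).aemeasurable_fst
  have heval : ∀ (S : Finset ℕ) (k : S), Measurable fun x : S → ℝ => x k := fun S k =>
    measurable_pi_apply k
  split_ifs with h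
  · obtain ⟨rfl, rfl⟩ := h
    have h13 : Measurable fun x => u₁ x * u₃ x := h₁.mul h₃
    have h24 : Measurable fun x => u₂ x * u₄ x := h₂.mul h₄
    have := ((hindep.indepFun hip.ne).comp h13 h24).integral_fun_mul_eq_mul_integral
      (h13.comp_aemeasurable (hX i)).aestronglyMeasurable
      (h24.comp_aemeasurable (hX p)).aestronglyMeasurable
    rw [← integral_comp_eq hident h13 i, ← integral_comp_eq hident h24 p]
    refine Eq.trans (integral_congr_ae (ae_of_all _ fun ω => ?_)) this
    simp only [Function.comp]
    ring
  · rcases lt_trichotomy p q with hpq | rfl | hpq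
    · have hS : q ∉ ({i, p, j} : Finset ℕ) := by simp; omega
      have := hindep.integral_mul_eq_zero hX hS
        (φ := fun x => u₁ (x ⟨i, by simp⟩) * u₂ (x ⟨p, by simp⟩) * u₃ (x ⟨j, by simp⟩))
        (((h₁.comp (heval _ _)).mul (h₂.comp (heval _ _))).mul (h₃.comp (heval _ _)))
        h₄ ((integral_comp_eq hident h₄ q).trans z₄)
      simpa only [mul_assoc] using this
    · have hS : i ∉ ({p, j} : Finset ℕ) := by simp; omega
      have := hindep.integral_mul_eq_zero hX hS
        (φ := fun x => u₂ (x ⟨p, by simp⟩) * u₃ (x ⟨j, by simp⟩) * u₄ (x ⟨p, by simp⟩))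
        (((h₂.comp (heval _ _)).mul (h₃.comp (heval _ _))).mul (h₄.comp (heval _ _)))
        h₁ ((integral_comp_eq hident h₁ i).trans z₁)
      rw [← this]
      exact integral_congr_ae (ae_of_all _ fun ω => by ring)
    · have hS : p ∉ ({i, j, q} : Finset ℕ) := by simp; omega
      have := hindep.integral_mul_eq_zero hX hS
        (φ := fun x => u₁ (x ⟨i, by simp⟩) * u₃ (x ⟨j, by simp⟩) * u₄ (x ⟨q, by simp⟩))
        (((h₁.comp (heval _ _)).mul (h₃.comp (heval _ _))).mul (h₄.comp (heval _ _)))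
        h₂ ((integral_comp_eq hident h₂ p).trans z₂)
      rw [← this]
      exact integral_congr_ae (ae_of_all _ fun ω => by ring)

include hindep hident in
lemma isOrthogonalNoise_comp {u : ℝ → ℝ} (hu : Measurable u)
    (hu2 : MemLp (fun ω => u (X 0 ω)) 2 P) (hu0 : ∫ ω, u (X 0 ω) ∂P = 0) :
    IsOrthogonalNoise P (fun i ω => u (X i ω)) (∫ ω, u (X 0 ω) ^ 2 ∂P) where
  memLp := memLp_comp hident hu hu2
  integral_mul i j := by
    split_ifs with h
    · subst h
      simp_rw [← sq]
      exact integral_comp_eq hident (hu.pow_const 2) i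
    · have hX : ∀ n, AEMeasurable (X n) P := fun n => (hident n).aemeasurable_fst
      have := ((hindep.indepFun h).comp hu hu).integral_fun_mul_eq_mul_integral
        (hu.comp_aemeasurable (hX i)).aestronglyMeasurable
        (hu.comp_aemeasurable (hX j)).aestronglyMeasurable
      simp only [Function.comp] at this
      rw [this, integral_comp_eq hident hu i, hu0, zero_mul]

include hindep hident in
lemma isOrthogonalNoise_lagged {u v : ℝ → ℝ} (hu : Measurable u) (hv : Measurable v)
    (hu2 : MemLp (fun ω => u (X 0 ω)) 2 P) (hv2 : MemLp (fun ω => v (X 0 ω)) 2 P)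
    (hu0 : ∫ ω, u (X 0 ω) ∂P = 0) (hv0 : ∫ ω, v (X 0 ω) ∂P = 0) {k : ℕ} (hk : 0 < k) :
    IsOrthogonalNoise P (fun i ω => u (X i ω) * v (X (i + k) ω))
      ((∫ ω, u (X 0 ω) ^ 2 ∂P) * ∫ ω, v (X 0 ω) ^ 2 ∂P) where
  memLp i := memLp_mul_of_ne hindep hident hu hv hu2 hv2 (by omega)
  integral_mul i j := by
    rw [integral_lagged_mul_lagged hindep hident hu hv hu hv hu0 hv0 hv0 (by omega) (by omega)]
    simp [sq]

variable {m K : ℕ} {h : Fin m → ℝ → ℝ}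

include hindep hident in
/-- Linear combinations of lagged products of an orthonormal system are orthogonal noise. -/
lemma isOrthogonalNoise_linearCombination (hm : ∀ a, Measurable (h a))
    (h2 : ∀ a, MemLp (fun ω => h a (X 0 ω)) 2 P) (h0 : ∀ a, ∫ ω, h a (X 0 ω) ∂P = 0)
    (horth : ∀ a b, ∫ ω, h a (X 0 ω) * h b (X 0 ω) ∂P = if a = b then 1 else 0)
    (t : Fin K × Fin m × Fin m → ℝ) :
    IsOrthogonalNoise P (fun i ω => ∑ p, t p * (h p.2.1 (X i ω) *
      h p.2.2 (X (i + (p.1 + 1)) ω))) (∑ p, t p ^ 2) where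
  memLp i := memLp_finsetSum _ fun p _ =>
    (memLp_mul_of_ne hindep hident (hm _) (hm _) (h2 _) (h2 _) (by omega)).const_mul _
  integral_mul i j := by
    have hL : ∀ i (p : Fin K × Fin m × Fin m),
        MemLp (fun ω => h p.2.1 (X i ω) * h p.2.2 (X (i + (p.1 + 1)) ω)) 2 P := fun i p =>
      memLp_mul_of_ne hindep hident (hm _) (hm _) (h2 _) (h2 _) (by omega)
    have hI : ∀ (p q : Fin K × Fin m × Fin m), Integrable (fun ω =>
        t p * (h p.2.1 (X i ω) * h p.2.2 (X (i + (p.1 + 1)) ω)) *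
          (t q * (h q.2.1 (X j ω) * h q.2.2 (X (j + (q.1 + 1)) ω)))) P := fun p q =>
      ((hL i p).const_mul _).integrable_mul ((hL j q).const_mul _)
    simp only [sum_mul_sum]
    rw [integral_finsetSum _ fun p _ => integrable_finsetSum _ fun q _ => hI p q]
    simp_rw [integral_finsetSum _ fun q _ => hI _ q]
    have hpq : ∀ p q : Fin K × Fin m × Fin m, ∫ ω,
        t p * (h p.2.1 (X i ω) * h p.2.2 (X (i + (p.1 + 1)) ω)) *
          (t q * (h q.2.1 (X j ω) * h q.2.2 (X (j + (q.1 + 1)) ω))) ∂P =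
        if p = q then (if i = j then t p ^ 2 else 0) else 0 := by
      rintro ⟨k, a, b⟩ ⟨l, c, d⟩
      rw [integral_congr_ae (ae_of_all _ fun ω => mul_mul_mul_comm _ _ _ _), integral_const_mul, integral_lagged_mul_lagged hindep hident (hm _) (hm _) (hm _) (hm _)
        (h0 _) (h0 _) (h0 _) (by omega) (by omega), horth, horth]
      simp only [Prod.mk.injEq]
      by_cases hij : i = j
      · subst hij
        by_cases hkl : k = l
        · subst hkl
          by_cases hac : a = c
          · subst hac
            by_cases hbd : b = d
            · subst hbd
              simp [sq]
            · simp [hbd]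
          · simp [hac]
        · simp [hkl, Fin.val_inj]
      · simp [hij]
    simp [hpq]

variable [IsProbabilityMeasure P]

include hindep hident in
/-- The normalized sums of the lagged products of an orthonormal system converge in distribution
to the standard Gaussian vector. -/
theorem tendstoInDistribution_lagged_products (hm : ∀ a, Measurable (h a))
    (h2 : ∀ a, MemLp (fun ω => h a (X 0 ω)) 2 P) (h0 : ∀ a, ∫ ω, h a (X 0 ω) ∂P = 0)
    (horth : ∀ a b, ∫ ω, h a (X 0 ω) * h b (X 0 ω) ∂P = if a = b then 1 else 0) :
    TendstoInDistribution (fun N : ℕ => fun ω => WithLp.toLp 2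
        fun p : Fin K × Fin m × Fin m =>
          (√N)⁻¹ * ∑ i ∈ range N, h p.2.1 (X i ω) * h p.2.2 (X (i + (p.1 + 1)) ω))
      atTop (fun x : EuclideanSpace ℝ (Fin K × Fin m × Fin m) => x)
      (fun _ => P) (multivariateGaussian 0 1) := by
  have hX : ∀ n, AEMeasurable (X n) P := fun n => (hident n).aemeasurable_fst
  have hmeas : ∀ N : ℕ, AEMeasurable (fun ω => WithLp.toLp 2
        fun p : Fin K × Fin m × Fin m =>
          (√N)⁻¹ * ∑ i ∈ range N, h p.2.1 (X i ω) * h p.2.2 (X (i + (p.1 + 1)) ω)) P := by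
    intro N
    refine (WithLp.measurable_toLp 2 _).comp_aemeasurable (aemeasurable_pi_lambda _ fun p => ?_)
    exact (Finset.aemeasurable_fun_sum _ fun i _ =>
      ((hm _).comp_aemeasurable (hX _)).mul ((hm _).comp_aemeasurable (hX _))).const_mul _
  refine ⟨hmeas, by fun_prop, ProbabilityMeasure.tendsto_iff_tendsto_charFun.2 fun t => ?_⟩
  simp only [ProbabilityMeasure.coe_mk, Measure.map_id']
  rw [charFun_multivariateGaussian Matrix.PosSemidef.one]
  -- Cramér–Wold: the vector's characteristic function at `t` is that of the `t`-combination at `1`.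
  have hnoise := isOrthogonalNoise_linearCombination hindep hident hm h2 h0 horth t
  have hmean : ∀ i, ∫ ω, ∑ p : Fin K × Fin m × Fin m,
      t p * (h p.2.1 (X i ω) * h p.2.2 (X (i + (p.1 + 1)) ω)) ∂P = 0 := by
    intro i
    rw [integral_finsetSum _ fun p _ => ((memLp_mul_of_ne hindep hident (hm _) (hm _) (h2 _) (h2 _)
      (by omega)).const_mul _).integrable (by norm_num)]
    refine Finset.sum_eq_zero fun p _ => ?_
    have hne : i ≠ i + ((p.1 : ℕ) + 1) := by omega
    have := ((hindep.indepFun hne).comp (hm p.2.1) (hm p.2.2)).integral_fun_mul_eq_mul_integral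
        ((hm _).comp_aemeasurable (hX _)).aestronglyMeasurable
        ((hm _).comp_aemeasurable (hX _)).aestronglyMeasurable
    simp only [Function.comp] at this
    rw [integral_const_mul, this, integral_comp_eq hident (hm _) i, h0, zero_mul, mul_zero]
  have hG : Measurable fun x : Fin (K + 1) → ℝ => ∑ p : Fin K × Fin m × Fin m,
      t p * (h p.2.1 (x 0) * h p.2.2 (x p.1.succ)) :=
    Finset.measurable_fun_sum _ fun p _ => (((hm _).comp (measurable_pi_apply _)).mul
      ((hm _).comp (measurable_pi_apply _))).const_mul _
  have hclt := tendsto_charFun_orthogonal_finiteRange hindep hident hG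
    (Z := fun i ω => ∑ p : Fin K × Fin m × Fin m,
      t p * (h p.2.1 (X i ω) * h p.2.2 (X (i + (p.1 + 1)) ω)))
    (fun i ω => by simp) hnoise hmean
  have hlim : Complex.exp (-((∑ p, t p ^ 2) / 2 : ℝ)) =
      Complex.exp ((inner ℝ t (0 : EuclideanSpace ℝ (Fin K × Fin m × Fin m)) : ℝ) * Complex.I -
        ((t.ofLp ⬝ᵥ (1 : Matrix _ _ ℝ).mulVec t.ofLp : ℝ) : ℂ) / 2) := by
    simp [dotProduct, sq]
  rw [← hlim]
  refine hclt.congr fun N => ?_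
  rw [charFun_apply_real, charFun_apply, integral_map ?_ (by fun_prop),
    integral_map (hmeas N) (by fun_prop)]
  · refine integral_congr_ae (ae_of_all _ fun ω => ?_)
    simp only [PiLp.inner_apply, Complex.ofReal_one, one_mul]
    congr 3
    simp only [RCLike.inner_apply, conj_trivial, mul_sum]
    rw [sum_comm]
    exact sum_congr rfl fun p _ => sum_congr rfl fun i _ => by ring
  · refine (Finset.aemeasurable_fun_sum _ fun i _ => ?_).const_mul _
    exact (hnoise.memLp i).aestronglyMeasurable.aemeasurable

end LaggedProducts

/-! ### Replacing empirical means by true means. -/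

section EmpiricalCovariance

open Finset IIDTest

variable {Ω : Type*} {X : ℕ → Ω → ℝ}

lemma empMean_sub_const {N : ℕ} (hN : N ≠ 0) (f : ℝ → ℝ) (c : ℝ) (ω : Ω) :
    empMean X N (fun x => f x - c) ω = empMean X N f ω - c := by
  have : (N : ℝ) ≠ 0 := by exact_mod_cast hN
  simp only [empMean, sum_sub_distrib, sum_const, card_range, nsmul_eq_mul]
  field_simp

lemma empCov_sub_const (N k : ℕ) (f g : ℝ → ℝ) (c d : ℝ) (ω : Ω) :
    empCov X N k (fun x => f x - c) (fun x => g x - d) ω = empCov X N k f g ω := by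
  -- At `N = 0` the empirical mean is `0` and ignores the shift, but the covariance sum is empty.
  rcases eq_or_ne N 0 with rfl | hN
  · simp [empCov]
  · simp only [empCov, empMean_sub_const hN, sub_sub_sub_cancel_right]

lemma empCov_zero_eq {N : ℕ} (hN : N ≠ 0) (f g : ℝ → ℝ) (ω : Ω) :
    empCov X N 0 f g ω = empMean X N (fun x => f x * g x) ω -
      empMean X N f ω * empMean X N g ω := by
  have hN' : (N : ℝ) ≠ 0 := by exact_mod_cast hN
  have hf : ∑ i ∈ range N, f (X i ω) = N * empMean X N f ω := by
    rw [empMean]; field_simp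
  have hg : ∑ i ∈ range N, g (X i ω) = N * empMean X N g ω := by
    rw [empMean]; field_simp
  have hfg : ∑ i ∈ range N, f (X i ω) * g (X i ω) = N * empMean X N (fun x => f x * g x) ω := by
    rw [empMean]; field_simp
  simp only [empCov, sub_mul, mul_sub, sum_sub_distrib, ← sum_mul, ← mul_sum, hf, hg, hfg,
    sum_const, card_range, nsmul_eq_mul, Nat.cast_zero, sub_zero, add_zero, Nat.sub_zero]
  field_simp
  ring

/-- The mean corrections become products of two noise sums, each of L¹ norm `O(N)`. The shifted sum
is reindexed so that it too is a noise sum over a `Finset`. -/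
lemma empCov_eq_sum {N k : ℕ} (hk : k < N) (u v : ℝ → ℝ) (ω : Ω) :
    empCov X N k u v ω = ((N : ℝ) - k)⁻¹ * ∑ i ∈ range (N - k), u (X i ω) * v (X (i + k) ω)
      - ((N : ℝ) - k)⁻¹ * (N : ℝ)⁻¹ *
        ((∑ i ∈ range (N - k), u (X i ω)) * ∑ i ∈ range N, v (X i ω))
      - ((N : ℝ) - k)⁻¹ * (N : ℝ)⁻¹ * ((∑ i ∈ range N, u (X i ω)) *
        ∑ i ∈ (range (N - k)).map (addRightEmbedding k), v (X i ω))
      + (N : ℝ)⁻¹ * (N : ℝ)⁻¹ * ((∑ i ∈ range N, u (X i ω)) * ∑ i ∈ range N, v (X i ω)) := by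
  have hn : (N : ℝ) - k ≠ 0 := by
    have : (k : ℝ) < N := by exact_mod_cast hk
    linarith
  have hN : (N : ℝ) ≠ 0 := by exact_mod_cast (by omega : N ≠ 0)
  simp only [empCov, empMean, sub_mul, mul_sub, sum_sub_distrib, ← sum_mul, ← mul_sum,
    sum_const, card_range, nsmul_eq_mul, sum_map, addRightEmbedding_apply, Nat.cast_sub hk.le]
  field_simp
  ring

variable [MeasurableSpace Ω] {P : Measure Ω}

lemma IsOrthogonalNoise.integral_abs_sum_mul_sum_le {Y Z : ℕ → Ω → ℝ} {α β : ℝ}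
    (hY : IsOrthogonalNoise P Y α) (hZ : IsOrthogonalNoise P Z β) {r s : Finset ℕ} {N : ℕ}
    (hr : #r ≤ N) (hs : #s ≤ N) :
    ∫ ω, |(∑ i ∈ r, Y i ω) * ∑ i ∈ s, Z i ω| ∂P ≤ (α + β) * N := by
  have hI1 := (hY.memLp_sum r).integrable_sq
  have hI2 := (hZ.memLp_sum s).integrable_sq
  calc ∫ ω, |(∑ i ∈ r, Y i ω) * ∑ i ∈ s, Z i ω| ∂P
      ≤ ∫ ω, ((∑ i ∈ r, Y i ω) ^ 2 + (∑ i ∈ s, Z i ω) ^ 2) ∂P := by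
        refine integral_mono ((hY.memLp_sum r).integrable_mul (hZ.memLp_sum s)).abs
          (hI1.add hI2) fun ω => ?_
        rw [abs_mul]
        nlinarith [sq_nonneg (|∑ i ∈ r, Y i ω| - |∑ i ∈ s, Z i ω|), sq_abs (∑ i ∈ r, Y i ω),
          sq_abs (∑ i ∈ s, Z i ω), sq_nonneg (∑ i ∈ r, Y i ω), sq_nonneg (∑ i ∈ s, Z i ω)]
    _ = α * #r + β * #s := by
        rw [integral_add hI1 hI2, hY.integral_sum_sq, hZ.integral_sum_sq]
    _ ≤ (α + β) * N := by
        rw [add_mul]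
        have h1 : (#r : ℝ) ≤ N := by exact_mod_cast hr
        have h2 : (#s : ℝ) ≤ N := by exact_mod_cast hs
        exact add_le_add (mul_le_mul_of_nonneg_left h1 hY.nonneg)
          (mul_le_mul_of_nonneg_left h2 hZ.nonneg)

lemma integrable_empCov (hident : ∀ n, IdentDistrib (X n) (X 0) P P)
    {u v : ℝ → ℝ} (hu : Measurable u) (hv : Measurable v)
    (hu2 : MemLp (fun ω => u (X 0 ω)) 2 P) (hv2 : MemLp (fun ω => v (X 0 ω)) 2 P) (N k : ℕ) :
    Integrable (empCov X N k u v) P := by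
  refine Integrable.const_mul (integrable_finsetSum _ fun i _ => ?_) _
  have hmean : ∀ {w : ℝ → ℝ}, Measurable w → MemLp (fun ω => w (X 0 ω)) 2 P →
      MemLp (empMean X N w) 2 P := fun hw hw2 =>
    (memLp_finsetSum _ fun i _ => memLp_comp hident hw hw2 i).const_mul _
  exact ((memLp_comp hident hu hu2 i).sub (hmean hu hu2)).integrable_mul
    ((memLp_comp hident hv hv2 _).sub (hmean hv hv2))

variable [IsProbabilityMeasure P]

/-- Put `n = N - k`. Changing the normalization and truncating costs second moment `αβ k / n`. The
mean corrections carry a factor of at most `√N / (n N)` against products of size `O(N)`, hence are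
`O(√N / n)`. -/
lemma tendsto_integral_abs_empCov_sub (hindep : iIndepFun X P)
    (hident : ∀ n, IdentDistrib (X n) (X 0) P P)
    {u v : ℝ → ℝ} (hu : Measurable u) (hv : Measurable v)
    (hu2 : MemLp (fun ω => u (X 0 ω)) 2 P) (hv2 : MemLp (fun ω => v (X 0 ω)) 2 P)
    (hu0 : ∫ ω, u (X 0 ω) ∂P = 0) (hv0 : ∫ ω, v (X 0 ω) ∂P = 0) {k : ℕ} (hk : 0 < k) :
    Tendsto (fun N : ℕ => ∫ ω, |√N * empCov X N k u v ω -
      (√N)⁻¹ * ∑ i ∈ range N, u (X i ω) * v (X (i + k) ω)| ∂P) atTop (nhds 0) := by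
  have nu := isOrthogonalNoise_comp hindep hident hu hu2 hu0
  have nv := isOrthogonalNoise_comp hindep hident hv hv2 hv0
  have nuv := isOrthogonalNoise_lagged hindep hident hu hv hu2 hv2 hu0 hv0 hk
  set α := ∫ ω, u (X 0 ω) ^ 2 ∂P
  set β := ∫ ω, v (X 0 ω) ^ 2 ∂P
  have hbound : ∀ᶠ N : ℕ in atTop, ∫ ω, |√N * empCov X N k u v ω -
      (√N)⁻¹ * ∑ i ∈ range N, u (X i ω) * v (X (i + k) ω)| ∂P ≤
      √(α * β * (k * ((N : ℝ) - k)⁻¹)) + 3 * (α + β) * (√N * ((N : ℝ) - k)⁻¹) := by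
    filter_upwards [eventually_gt_atTop k] with N hN
    have hNr : (0 : ℝ) < N := by exact_mod_cast (by omega : 0 < N)
    have hkN : (k : ℝ) < N := by exact_mod_cast hN
    have hn : (0 : ℝ) < (N : ℝ) - k := by linarith
    set n : ℝ := (N : ℝ) - k with hndef
    have hsN : 0 < √(N : ℝ) := Real.sqrt_pos.2 hNr
    have eN : √(N : ℝ) ^ 2 = N := Real.sq_sqrt hNr.le
    let A : Ω → ℝ := fun ω => (√N)⁻¹ * ∑ i ∈ range N, u (X i ω) * v (X (i + k) ω) -
      (√N * n⁻¹) * ∑ i ∈ range (N - k), u (X i ω) * v (X (i + k) ω)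
    let T₁ : Ω → ℝ := fun ω => (∑ i ∈ range (N - k), u (X i ω)) * ∑ i ∈ range N, v (X i ω)
    let T₂ : Ω → ℝ := fun ω => (∑ i ∈ range N, u (X i ω)) *
      ∑ i ∈ (range (N - k)).map (addRightEmbedding k), v (X i ω)
    let T₃ : Ω → ℝ := fun ω => (∑ i ∈ range N, u (X i ω)) * ∑ i ∈ range N, v (X i ω)
    have hA : MemLp A 2 P := ((nuv.memLp_sum _).const_mul _).sub ((nuv.memLp_sum _).const_mul _)
    have hT₁ : Integrable T₁ P := (nu.memLp_sum _).integrable_mul (nv.memLp_sum _)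
    have hT₂ : Integrable T₂ P := (nu.memLp_sum _).integrable_mul (nv.memLp_sum _)
    have hT₃ : Integrable T₃ P := (nu.memLp_sum _).integrable_mul (nv.memLp_sum _)
    have hA' : ∫ ω, |A ω| ∂P ≤ √(α * β * (k * n⁻¹)) := by
      refine (integral_abs_le_sqrt hA).trans (Real.sqrt_le_sqrt (le_of_eq ?_))
      rw [nuv.integral_sub_sq (range_subset_range.2 (Nat.sub_le N k)), card_range, card_range,
        Nat.cast_sub hN.le, ← hndef]
      congr 1
      have hk' : (k : ℝ) = √(N : ℝ) ^ 2 - n := by rw [eN]; ring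
      rw [hk']
      conv_lhs => rw [← eN, Real.sqrt_sq hsN.le]
      field_simp
      ring
    have hc : 0 ≤ √(N : ℝ) * n⁻¹ * (N : ℝ)⁻¹ := by positivity
    have hpt : ∀ ω, |√N * empCov X N k u v ω -
        (√N)⁻¹ * ∑ i ∈ range N, u (X i ω) * v (X (i + k) ω)| ≤
        |A ω| + (√N * n⁻¹ * (N : ℝ)⁻¹) * (|T₁ ω| + |T₂ ω| + |T₃ ω|) := by
      intro ω
      have h1 : √N * empCov X N k u v ω -
          (√N)⁻¹ * ∑ i ∈ range N, u (X i ω) * v (X (i + k) ω) =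
          -A ω - (√N * n⁻¹ * (N : ℝ)⁻¹) * T₁ ω - (√N * n⁻¹ * (N : ℝ)⁻¹) * T₂ ω +
            (√N * (N : ℝ)⁻¹ * (N : ℝ)⁻¹) * T₃ ω := by
        rw [empCov_eq_sum hN]
        simp only [A, T₁, T₂, T₃]
        ring
      have h2 : √(N : ℝ) * (N : ℝ)⁻¹ * (N : ℝ)⁻¹ ≤ √(N : ℝ) * n⁻¹ * (N : ℝ)⁻¹ := by
        have : (N : ℝ)⁻¹ ≤ n⁻¹ := inv_anti₀ hn (by simp [hndef])
        gcongr
      have h3 : |(√N * (N : ℝ)⁻¹ * (N : ℝ)⁻¹) * T₃ ω| ≤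
          (√N * n⁻¹ * (N : ℝ)⁻¹) * |T₃ ω| := by
        rw [abs_mul, abs_of_nonneg (by positivity : 0 ≤ √(N : ℝ) * (N : ℝ)⁻¹ * (N : ℝ)⁻¹)]
        gcongr
      have h4 : ∀ T, |(√N * n⁻¹ * (N : ℝ)⁻¹) * T| = (√N * n⁻¹ * (N : ℝ)⁻¹) * |T| := fun T => by
        rw [abs_mul, abs_of_nonneg hc]
      rw [h1]
      calc _ ≤ |-A ω| + |(√N * n⁻¹ * (N : ℝ)⁻¹) * T₁ ω| + |(√N * n⁻¹ * (N : ℝ)⁻¹) * T₂ ω| +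
            |(√N * (N : ℝ)⁻¹ * (N : ℝ)⁻¹) * T₃ ω| :=
            (abs_add_le _ _).trans (add_le_add_left ((abs_sub _ _).trans
              (add_le_add_left (abs_sub _ _) _)) _)
        _ ≤ _ := by
            rw [abs_neg, h4, h4]
            linarith
    have b₁ : ∫ ω, |T₁ ω| ∂P ≤ (α + β) * N :=
      nu.integral_abs_sum_mul_sum_le nv (by simp) (by simp)
    have b₂ : ∫ ω, |T₂ ω| ∂P ≤ (α + β) * N :=
      nu.integral_abs_sum_mul_sum_le nv (by simp) (by simp)
    have b₃ : ∫ ω, |T₃ ω| ∂P ≤ (α + β) * N :=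
      nu.integral_abs_sum_mul_sum_le nv (by simp) (by simp)
    have hIA := (hA.integrable (by norm_num)).abs
    have hI₁₂ : Integrable (fun ω => |T₁ ω| + |T₂ ω|) P := hT₁.abs.add hT₂.abs
    have hI₁₂₃ : Integrable (fun ω => |T₁ ω| + |T₂ ω| + |T₃ ω|) P := hI₁₂.add hT₃.abs
    have hIT := hI₁₂₃.const_mul (√N * n⁻¹ * (N : ℝ)⁻¹)
    have hIL : Integrable (fun ω => |√N * empCov X N k u v ω -
        (√N)⁻¹ * ∑ i ∈ range N, u (X i ω) * v (X (i + k) ω)|) P :=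
      (Integrable.sub' ((integrable_empCov hident hu hv hu2 hv2 N k).const_mul _)
        (((nuv.memLp_sum _).integrable (by norm_num)).const_mul _)).abs
    calc _ ≤ ∫ ω, (|A ω| + (√N * n⁻¹ * (N : ℝ)⁻¹) * (|T₁ ω| + |T₂ ω| + |T₃ ω|)) ∂P :=
          integral_mono hIL (hIA.add hIT) hpt
      _ = ∫ ω, |A ω| ∂P + (√N * n⁻¹ * (N : ℝ)⁻¹) *
          (∫ ω, |T₁ ω| ∂P + ∫ ω, |T₂ ω| ∂P + ∫ ω, |T₃ ω| ∂P) := by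
          rw [integral_add hIA hIT, integral_const_mul,
            integral_add hI₁₂ hT₃.abs, integral_add hT₁.abs hT₂.abs]
      _ ≤ √(α * β * (k * n⁻¹)) + (√N * n⁻¹ * (N : ℝ)⁻¹) *
          ((α + β) * N + (α + β) * N + (α + β) * N) := by gcongr
      _ = _ := by
          field_simp
          ring
  have hlim : Tendsto (fun N : ℕ => √(α * β * (k * ((N : ℝ) - k)⁻¹)) +
      3 * (α + β) * (√N * ((N : ℝ) - k)⁻¹)) atTop
      (nhds (√(α * β * (k * 0)) + 3 * (α + β) * 0)) := by
    have h1 : Tendsto (fun N : ℕ => ((N : ℝ) - k)⁻¹) atTop (nhds 0) :=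
      (tendsto_atTop_add_const_right _ (-(k : ℝ)) tendsto_natCast_atTop_atTop).inv_tendsto_atTop
    have h2 : Tendsto (fun N : ℕ => √N * ((N : ℝ) - k)⁻¹) atTop (nhds 0) := by
      have h3 : Tendsto (fun N : ℕ => 1 - (k : ℝ) / N) atTop (nhds (1 - 0)) :=
        tendsto_const_nhds.sub (tendsto_const_div_atTop_nhds_zero_nat _)
      have h4 : Tendsto (fun N : ℕ => (√(N : ℝ))⁻¹) atTop (nhds 0) :=
        (Real.tendsto_sqrt_atTop.comp tendsto_natCast_atTop_atTop).inv_tendsto_atTop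
      have h5 := h4.mul (h3.inv₀ (by norm_num))
      rw [zero_mul] at h5
      refine h5.congr' ?_
      filter_upwards [eventually_gt_atTop k] with N hN
      have hNr : (0 : ℝ) < N := by exact_mod_cast (by omega : 0 < N)
      have hkN : (k : ℝ) < N := by exact_mod_cast hN
      have hn : (N : ℝ) - k ≠ 0 := by linarith
      have eN : √(N : ℝ) ^ 2 = N := Real.sq_sqrt hNr.le
      have hsN : 0 < √(N : ℝ) := Real.sqrt_pos.2 hNr
      rw [one_sub_div hNr.ne', inv_div]
      field_simp
      rw [eN]
    exact ((Real.continuous_sqrt.tendsto _).comp ((h1.const_mul _).const_mul _)).add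
      (h2.const_mul _)
  simp only [mul_zero, Real.sqrt_zero, add_zero] at hlim
  exact tendsto_of_tendsto_of_tendsto_of_le_of_le' tendsto_const_nhds hlim
    (Eventually.of_forall fun N => integral_nonneg fun ω => abs_nonneg _) hbound

/-- Markov's inequality for the ℓ¹ norm, which dominates the Euclidean norm. -/
lemma tendstoInMeasure_toLp_of_tendsto_integral_abs {ι : Type*} [Fintype ι]
    {D : ℕ → ι → Ω → ℝ} (hD : ∀ N p, Integrable (D N p) P)
    (hlim : ∀ p, Tendsto (fun N => ∫ ω, |D N p ω| ∂P) atTop (nhds 0)) :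
    TendstoInMeasure P (fun N ω => (WithLp.toLp 2 fun p => D N p ω : EuclideanSpace ℝ ι))
      atTop 0 := by
  rw [tendstoInMeasure_iff_measureReal_norm]
  intro ε hε
  have hsum : Tendsto (fun N => ε⁻¹ * ∑ p, ∫ ω, |D N p ω| ∂P) atTop (nhds 0) := by
    have := (tendsto_finsetSum univ fun p _ => hlim p).const_mul ε⁻¹
    simpa using this
  refine squeeze_zero (fun _ => measureReal_nonneg) (fun N => ?_) hsum
  have hI : Integrable (fun ω => ∑ p, |D N p ω|) P :=
    integrable_finsetSum _ fun p _ => (hD N p).abs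
  have hmarkov := mul_meas_ge_le_integral_of_nonneg (μ := P) (f := fun ω => ∑ p, |D N p ω|)
    (ae_of_all _ fun ω => sum_nonneg fun p _ => abs_nonneg _) hI ε
  rw [integral_finsetSum _ fun p _ => (hD N p).abs] at hmarkov
  rw [inv_mul_eq_div, le_div_iff₀' hε]
  refine le_trans (mul_le_mul_of_nonneg_left (measureReal_mono fun ω hω => ?_) hε.le) hmarkov
  simp only [Set.mem_ofPred_eq, Pi.zero_apply, sub_zero] at hω ⊢
  refine hω.trans ?_
  rw [EuclideanSpace.norm_eq]
  refine Real.sqrt_le_iff.2 ⟨sum_nonneg fun p _ => abs_nonneg _, ?_⟩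
  exact sum_sq_le_sq_sum_of_nonneg fun p _ => abs_nonneg _

end EmpiricalCovariance

/-! ### Action of `B ⊗ B` and Slutsky's theorem. -/

section Whitening

open Finset IIDTest

variable {m K : ℕ}

/-- The action of `B ⊗ B` on each of the `K` blocks of a vector in `ℝ^{m² K}`. -/
noncomputable def blockKronecker (x : EuclideanSpace ℝ (Fin K × Fin m × Fin m))
    (B : Fin m → Fin m → ℝ) : EuclideanSpace ℝ (Fin K × Fin m × Fin m) :=
  WithLp.toLp 2 fun p => ∑ q : Fin m × Fin m, B p.2.1 q.1 * B p.2.2 q.2 * x (p.1, q)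

/-- Slutsky's theorem needs continuity jointly in the vector and the matrix. -/
lemma continuous_blockKronecker :
    Continuous fun z : EuclideanSpace ℝ (Fin K × Fin m × Fin m) × (Fin m → Fin m → ℝ) =>
      blockKronecker z.1 z.2 := by
  unfold blockKronecker
  fun_prop

lemma whiten_eq_blockKronecker (N : ℕ) (B : Matrix (Fin m) (Fin m) ℝ)
    (v : ℕ → Fin m × Fin m → ℝ) :
    whiten K N B v = blockKronecker
      (WithLp.toLp 2 fun p : Fin K × Fin m × Fin m => √N * v (p.1 + 1) p.2) B := by
  ext p
  simp only [whiten, blockKronecker, Matrix.mulVec, dotProduct, Matrix.kroneckerMap_apply, mul_sum]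
  exact sum_congr rfl fun q _ => by ring

/-- The mixed product rule `(B ⊗ B)(A ⊗ A) = BA ⊗ BA`. -/
lemma blockKronecker_comp (x : EuclideanSpace ℝ (Fin K × Fin m × Fin m))
    (A B : Matrix (Fin m) (Fin m) ℝ) :
    blockKronecker (blockKronecker x A) B = blockKronecker x (B * A : Matrix _ _ ℝ) := by
  ext p
  simp only [blockKronecker, Matrix.mul_apply, mul_sum (s := (univ : Finset (Fin m × Fin m)))]
  rw [sum_comm]
  refine sum_congr rfl fun q _ => ?_
  rw [sum_mul_sum, Fintype.sum_prod_type, sum_mul]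
  refine sum_congr rfl fun a _ => ?_
  rw [sum_mul]
  exact sum_congr rfl fun b _ => by ring

lemma blockKronecker_one (x : EuclideanSpace ℝ (Fin K × Fin m × Fin m)) :
    blockKronecker x (1 : Matrix (Fin m) (Fin m) ℝ) = x := by
  ext p
  simp [blockKronecker, Fintype.sum_prod_type, Matrix.one_apply]

/-- Replacing correlations by covariances amounts to rescaling the whitening matrix. -/
lemma whiten_empCorrVec {Ω : Type*} (X : ℕ → Ω → ℝ) (N : ℕ) (B : Matrix (Fin m) (Fin m) ℝ)
    (f : Fin m → ℝ → ℝ) (ω : Ω) :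
    whiten K N B (fun k => empCorrVec X N k f ω) =
      whiten K N (B * Matrix.diagonal fun i => (empStd X N (f i) ω)⁻¹)
        (fun k => empCovVec X N k f ω) := by
  ext p
  simp only [whiten, Matrix.mulVec, dotProduct, Matrix.kroneckerMap_apply,
    Matrix.mul_diagonal, empCorrVec, empCovVec, empCorr]
  congr 1
  exact sum_congr rfl fun q _ => by rw [div_eq_mul_inv, mul_inv]; ring

variable {Ω : Type*} [MeasurableSpace Ω] {P : Measure Ω}
  {X : ℕ → Ω → ℝ} {f : Fin m → ℝ → ℝ}

lemma aemeasurable_empMean (hX : ∀ n, AEMeasurable (X n) P) {g : ℝ → ℝ} (hg : Measurable g)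
    (N : ℕ) : AEMeasurable (empMean X N g) P :=
  (Finset.aemeasurable_fun_sum _ fun i _ => hg.comp_aemeasurable (hX i)).const_mul _

lemma aemeasurable_empCov (hX : ∀ n, AEMeasurable (X n) P) {g h : ℝ → ℝ} (hg : Measurable g)
    (hh : Measurable h) (N k : ℕ) : AEMeasurable (empCov X N k g h) P :=
  (Finset.aemeasurable_fun_sum _ fun i _ =>
    ((hg.comp_aemeasurable (hX i)).sub (aemeasurable_empMean hX hg N)).mul
      ((hh.comp_aemeasurable (hX _)).sub (aemeasurable_empMean hX hh N))).const_mul _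

lemma aemeasurable_empStd (hX : ∀ n, AEMeasurable (X n) P) {g : ℝ → ℝ} (hg : Measurable g)
    (N : ℕ) : AEMeasurable (empStd X N g) P :=
  ((Finset.aemeasurable_fun_sum _ fun i _ =>
    ((hg.comp_aemeasurable (hX i)).sub (aemeasurable_empMean hX hg N)).pow_const 2).const_mul
      _).sqrt

variable [IsProbabilityMeasure P]

/-- If `B₀ᵀ B₀ = 𝒬⁻¹`, the functions `B₀ (f - E f)` form an orthonormal system. -/
lemma integral_mulVec_mul_mulVec (hf2 : ∀ i, MemLp (fun ω => f i (X 0 ω)) 2 P)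
    (hQ : (covMatrix P (X 0) f).PosDef) {B₀ : Matrix (Fin m) (Fin m) ℝ}
    (hB₀ : B₀.transpose * B₀ = (covMatrix P (X 0) f)⁻¹) (a b : Fin m) :
    ∫ ω, (∑ c, B₀ a c * (f c (X 0 ω) - ∫ ω, f c (X 0 ω) ∂P)) *
      (∑ d, B₀ b d * (f d (X 0 ω) - ∫ ω, f d (X 0 ω) ∂P)) ∂P = if a = b then 1 else 0 := by
  have hdet : IsUnit (covMatrix P (X 0) f).det := (Matrix.isUnit_iff_isUnit_det _).1 hQ.isUnit
  -- For square matrices one-sided inverses are two-sided, so `B₀ᵀ B₀ = 𝒬⁻¹` yields `B₀ 𝒬 B₀ᵀ = 1`,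
  -- the covariance of `B₀ f`.
  have hone : B₀ * (covMatrix P (X 0) f * B₀.transpose) = 1 := by
    rw [mul_eq_one_comm, Matrix.mul_assoc, hB₀, Matrix.mul_nonsing_inv _ hdet]
  have hu : ∀ c, MemLp (fun ω => f c (X 0 ω) - ∫ ω, f c (X 0 ω) ∂P) 2 P := fun c =>
    (hf2 c).sub (memLp_const _)
  have hI : ∀ c d, Integrable (fun ω => B₀ a c * (f c (X 0 ω) - ∫ ω, f c (X 0 ω) ∂P) *
      (B₀ b d * (f d (X 0 ω) - ∫ ω, f d (X 0 ω) ∂P))) P := fun c d =>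
    ((hu c).const_mul _).integrable_mul ((hu d).const_mul _)
  simp only [sum_mul_sum]
  rw [integral_finsetSum _ fun c _ => integrable_finsetSum _ fun d _ => hI c d]
  simp_rw [integral_finsetSum _ fun d _ => hI _ d]
  have hcd : ∀ c d, ∫ ω, B₀ a c * (f c (X 0 ω) - ∫ ω, f c (X 0 ω) ∂P) *
      (B₀ b d * (f d (X 0 ω) - ∫ ω, f d (X 0 ω) ∂P)) ∂P =
      B₀ a c * (covMatrix P (X 0) f c d * B₀ b d) := by
    intro c d
    rw [integral_congr_ae (ae_of_all _ fun ω => mul_mul_mul_comm _ _ _ _), integral_const_mul,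
      show ∫ ω, (f c (X 0 ω) - ∫ ω, f c (X 0 ω) ∂P) * (f d (X 0 ω) - ∫ ω, f d (X 0 ω) ∂P) ∂P =
        covMatrix P (X 0) f c d from rfl]
    ring
  have hentry := congrFun (congrFun hone a) b
  simp only [Matrix.mul_apply, Matrix.transpose_apply, Matrix.one_apply, mul_sum] at hentry
  simp_rw [hcd]
  exact hentry

/-- The vector of normalized lagged covariances is asymptotically `(B₀⁻¹ ⊗ B₀⁻¹) 𝒩(0, I)`. -/
lemma tendstoInDistribution_empCovVec (hindep : iIndepFun X P)
    (hident : ∀ n, IdentDistrib (X n) (X 0) P P) (hf : ∀ i, Measurable (f i))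
    (hf2 : ∀ i, MemLp (fun ω => f i (X 0 ω)) 2 P) (hQ : (covMatrix P (X 0) f).PosDef)
    {B₀ : Matrix (Fin m) (Fin m) ℝ} (hB₀ : B₀.transpose * B₀ = (covMatrix P (X 0) f)⁻¹)
    {C₀ : Matrix (Fin m) (Fin m) ℝ} (hC₀ : C₀ * B₀ = 1) :
    TendstoInDistribution (fun N : ℕ => fun ω => WithLp.toLp 2 fun p : Fin K × Fin m × Fin m =>
        √N * empCovVec X N (p.1 + 1) f ω p.2) atTop
      (fun x : EuclideanSpace ℝ (Fin K × Fin m × Fin m) => blockKronecker x C₀)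
      (fun _ => P) (multivariateGaussian 0 1) := by
  have hX : ∀ n, AEMeasurable (X n) P := fun n => (hident n).aemeasurable_fst
  let u : Fin m → ℝ → ℝ := fun c x => f c x - ∫ ω, f c (X 0 ω) ∂P
  have hum : ∀ c, Measurable (u c) := fun c => (hf c).sub_const _
  have hu2 : ∀ c, MemLp (fun ω => u c (X 0 ω)) 2 P := fun c => (hf2 c).sub (memLp_const _)
  have hu0 : ∀ c, ∫ ω, u c (X 0 ω) ∂P = 0 := fun c => by
    simp only [u]
    rw [integral_sub ((hf2 c).integrable (by norm_num)) (integrable_const _)]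
    simp
  let h : Fin m → ℝ → ℝ := fun a x => ∑ c, B₀ a c * u c x
  have hhm : ∀ a, Measurable (h a) := fun a =>
    Finset.measurable_fun_sum _ fun c _ => (hum c).const_mul _
  have hclt := tendstoInDistribution_lagged_products (K := K) hindep hident hhm
    (fun a => memLp_finsetSum _ fun c _ => (hu2 c).const_mul _)
    (fun a => by
      simp only [h]
      rw [integral_finsetSum _ fun c _ => ((hu2 c).const_mul _).integrable (by norm_num)]
      simp [integral_const_mul, hu0])
    (fun a b => integral_mulVec_mul_mulVec hf2 hQ hB₀ a b)
  have huh : ∀ c x, ∑ a, C₀ c a * h a x = u c x := by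
    intro c x
    have : C₀.mulVec (B₀.mulVec fun d => u d x) c = u c x := by
      rw [Matrix.mulVec_mulVec, hC₀, Matrix.one_mulVec]
    simpa [Matrix.mulVec, dotProduct] using this
  have hcont : Continuous fun x : EuclideanSpace ℝ (Fin K × Fin m × Fin m) =>
      blockKronecker x C₀ :=
    continuous_blockKronecker.comp (continuous_id.prodMk continuous_const)
  have hζ := hclt.continuous_comp hcont
  refine tendstoInDistribution_of_tendstoInMeasure_sub (X := _) _ _ hζ ?_ fun N => ?_
  · have hL := tendstoInMeasure_toLp_of_tendsto_integral_abs (P := P)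
      (D := fun N (p : Fin K × Fin m × Fin m) ω =>
        √N * empCov X N (p.1 + 1) (u p.2.1) (u p.2.2) ω -
          (√N)⁻¹ * ∑ i ∈ range N, u p.2.1 (X i ω) * u p.2.2 (X (i + (p.1 + 1)) ω))
      (fun N p => Integrable.sub'
        ((integrable_empCov hident (hum _) (hum _) (hu2 _) (hu2 _) N _).const_mul _)
        ((integrable_finsetSum _ fun i _ => (memLp_mul_of_ne hindep hident (hum _) (hum _) (hu2 _)
          (hu2 _) (by omega)).integrable (by norm_num)).const_mul _))
      (fun p => tendsto_integral_abs_empCov_sub hindep hident (hum _) (hum _) (hu2 _) (hu2 _)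
        (hu0 _) (hu0 _) (Nat.succ_pos _))
    refine hL.congr_left fun N => ae_of_all _ fun ω => ?_
    ext p
    simp only [Pi.sub_apply, Function.comp, PiLp.sub_apply, empCovVec, blockKronecker]
    rw [empCov_sub_const]
    congr 1
    simp only [mul_sum (range N)]
    rw [sum_comm]
    refine sum_congr rfl fun i _ => ?_
    rw [← huh, ← huh, sum_mul_sum, mul_sum, Fintype.sum_prod_type]
    refine sum_congr rfl fun a _ => ?_
    rw [mul_sum]
    exact sum_congr rfl fun b _ => by ring
  · exact (WithLp.measurable_toLp 2 _).comp_aemeasurable (aemeasurable_pi_lambda _ fun p =>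
      (aemeasurable_empCov hX (hf _) (hf _) N _).const_mul _)

/-- Whitening with any strongly consistent estimator of a square root of `𝒬⁻¹`. -/
theorem tendstoInDistribution_whiten (hindep : iIndepFun X P)
    (hident : ∀ n, IdentDistrib (X n) (X 0) P P) (hf : ∀ i, Measurable (f i))
    (hf2 : ∀ i, MemLp (fun ω => f i (X 0 ω)) 2 P) (hQ : (covMatrix P (X 0) f).PosDef)
    {B₀ : Matrix (Fin m) (Fin m) ℝ} (hB₀ : B₀.transpose * B₀ = (covMatrix P (X 0) f)⁻¹)
    {B : ℕ → Ω → Matrix (Fin m) (Fin m) ℝ}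
    (hBm : ∀ N i j, AEMeasurable (fun ω => B N ω i j) P)
    (hB : ∀ᵐ ω ∂P, Tendsto (fun N => B N ω) atTop (nhds B₀)) :
    TendstoInDistribution (fun N ω => whiten K N (B N ω) (fun k => empCovVec X N k f ω))
      atTop (fun x : EuclideanSpace ℝ (Fin K × Fin m × Fin m) => x)
      (fun _ => P) (multivariateGaussian 0 1) := by
  have hdet : IsUnit (covMatrix P (X 0) f).det := (Matrix.isUnit_iff_isUnit_det _).1 hQ.isUnit
  -- The explicit inverse `𝒬 B₀ᵀ` of `B₀`; its Kronecker square in the limit law is cancelled by `B₀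
  -- ⊗ B₀`.
  have hC₀ : (covMatrix P (X 0) f * B₀.transpose) * B₀ = 1 := by
    rw [Matrix.mul_assoc, hB₀, Matrix.mul_nonsing_inv _ hdet]
  have hBm' : ∀ N, AEMeasurable (β := Fin m → Fin m → ℝ) (B N) P := fun N =>
    aemeasurable_pi_lambda _ fun i => aemeasurable_pi_lambda _ fun j => hBm N i j
  have hBP : TendstoInMeasure (E := Fin m → Fin m → ℝ) P B atTop fun _ => B₀ :=
    tendstoInMeasure_of_tendsto_ae (fun N => (hBm' N).aestronglyMeasurable) hB
  have hmain := (tendstoInDistribution_empCovVec (K := K) hindep hident hf hf2 hQ hB₀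
    hC₀).continuous_comp_prodMk_of_tendstoInMeasure_const continuous_blockKronecker hBP hBm'
  refine hmain.congr (fun N => ae_of_all _ fun ω => ?_) (ae_of_all _ fun x => ?_)
  · exact (whiten_eq_blockKronecker N (B N ω) fun k => empCovVec X N k f ω).symm
  · exact (blockKronecker_comp x _ B₀).trans (by
      rw [mul_eq_one_comm.1 hC₀, blockKronecker_one])

end Whitening

/-! ### Strong consistency of the estimated matrices. -/

section Consistency

open Finset IIDTest

variable {m : ℕ}

lemma empStd_eq_sqrt {Ω : Type*} (X : ℕ → Ω → ℝ) (N : ℕ) (g : ℝ → ℝ) (ω : Ω) :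
    empStd X N g ω = √(empCov X N 0 g g ω) := by
  simp [empStd, empCov, sq]

lemma empCorrMatrix_eq {Ω : Type*} (X : ℕ → Ω → ℝ) (N : ℕ) (f : Fin m → ℝ → ℝ) (ω : Ω) :
    empCorrMatrix X N f ω = Matrix.diagonal (fun i => (empStd X N (f i) ω)⁻¹) *
      empCovMatrix X N f ω * Matrix.diagonal (fun i => (empStd X N (f i) ω)⁻¹) := by
  ext i j
  simp only [Matrix.mul_diagonal, Matrix.diagonal_mul, empCorrMatrix, empCovMatrix,
    Matrix.of_apply, empCorr]
  rw [div_eq_mul_inv, mul_inv]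
  ring

/-- It is `N⁻¹` times the Gram matrix `A Aᵀ` of the centred data. -/
lemma posSemidef_empCovMatrix {Ω : Type*} (X : ℕ → Ω → ℝ) (N : ℕ) (f : Fin m → ℝ → ℝ) (ω : Ω) :
    (empCovMatrix X N f ω).PosSemidef := by
  let A : Matrix (Fin m) (Fin N) ℝ := Matrix.of fun a i => f a (X i ω) - empMean X N (f a) ω
  have h : empCovMatrix X N f ω = (N : ℝ)⁻¹ • (A * A.conjTranspose) := by
    ext a b
    simp only [empCovMatrix, empCov, Matrix.of_apply, Matrix.smul_apply, Matrix.mul_apply,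
      Matrix.conjTranspose_apply, A, star_trivial, smul_eq_mul, Nat.cast_zero, sub_zero,
      add_zero, Nat.sub_zero]
    rw [Fin.sum_univ_eq_sum_range fun i => (f a (X i ω) - empMean X N (f a) ω) *
      (f b (X i ω) - empMean X N (f b) ω)]
  rw [h]
  exact (Matrix.posSemidef_self_mul_conjTranspose A).smul (by positivity)

/-- Congruence by a diagonal matrix; a vanishing `empStd` is harmless, since its inverse is then
`0`. -/
lemma posSemidef_empCorrMatrix {Ω : Type*} (X : ℕ → Ω → ℝ) (N : ℕ) (f : Fin m → ℝ → ℝ) (ω : Ω) :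
    (empCorrMatrix X N f ω).PosSemidef := by
  have h := (posSemidef_empCovMatrix X N f ω).mul_mul_conjTranspose_same
    (Matrix.diagonal (fun i => (empStd X N (f i) ω)⁻¹))
  rwa [Matrix.diagonal_conjTranspose, star_trivial, ← empCorrMatrix_eq] at h

/-- Continuity on positive definite matrices suffices along positive semidefinite sequences. -/
lemma tendsto_comp_of_posSemidef {Φ : Matrix (Fin m) (Fin m) ℝ → Matrix (Fin m) (Fin m) ℝ}
    (hΦ : ContinuousOn Φ {A | A.PosDef}) {A : ℕ → Matrix (Fin m) (Fin m) ℝ}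
    {A₀ : Matrix (Fin m) (Fin m) ℝ} (hA : ∀ N, (A N).PosSemidef) (hA₀ : A₀.PosDef)
    (h : Tendsto A atTop (nhds A₀)) : Tendsto (fun N => Φ (A N)) atTop (nhds (Φ A₀)) := by
  refine (hΦ A₀ hA₀).tendsto.comp (tendsto_nhdsWithin_iff.2 ⟨h, ?_⟩)
  -- A positive semidefinite matrix is definite iff its determinant is nonzero, which is an open
  -- condition.
  have hdet : Tendsto (fun N => (A N).det) atTop (nhds A₀.det) :=
    ((continuous_id.matrix_det).tendsto A₀).comp h
  filter_upwards [hdet.eventually_ne (hA₀.posSemidef.posDef_iff_det_ne_zero.1 hA₀)] with N hN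
  exact (hA N).posDef_iff_det_ne_zero.2 hN

variable {Ω : Type*} [MeasurableSpace Ω] {P : Measure Ω} {X : ℕ → Ω → ℝ} {f : Fin m → ℝ → ℝ}

lemma tendsto_empMean_ae (hindep : iIndepFun X P) (hident : ∀ n, IdentDistrib (X n) (X 0) P P)
    {g : ℝ → ℝ} (hg : Measurable g) (hgi : Integrable (fun ω => g (X 0 ω)) P) :
    ∀ᵐ ω ∂P, Tendsto (fun N => empMean X N g ω) atTop (nhds (∫ ω, g (X 0 ω) ∂P)) := by
  have h := strong_law_ae_real (fun n ω => g (X n ω)) hgi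
    (fun i j hij => (hindep.indepFun hij).comp hg hg) (fun i => (hident i).comp hg)
  filter_upwards [h] with ω hω
  refine hω.congr fun N => ?_
  rw [empMean, div_eq_inv_mul]

variable [IsProbabilityMeasure P]

lemma tendsto_empCovMatrix_ae (hindep : iIndepFun X P)
    (hident : ∀ n, IdentDistrib (X n) (X 0) P P) (hf : ∀ i, Measurable (f i))
    (hf2 : ∀ i, MemLp (fun ω => f i (X 0 ω)) 2 P) :
    ∀ᵐ ω ∂P, Tendsto (fun N => empCovMatrix X N f ω) atTop (nhds (covMatrix P (X 0) f)) := by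
  have h1 : ∀ᵐ ω ∂P, ∀ i, Tendsto (fun N => empMean X N (f i) ω) atTop
      (nhds (∫ ω, f i (X 0 ω) ∂P)) :=
    ae_all_iff.2 fun i => tendsto_empMean_ae hindep hident (hf i) ((hf2 i).integrable (by norm_num))
  have h2 : ∀ᵐ ω ∂P, ∀ i j, Tendsto (fun N => empMean X N (fun x => f i x * f j x) ω) atTop
      (nhds (∫ ω, f i (X 0 ω) * f j (X 0 ω) ∂P)) :=
    ae_all_iff.2 fun i => ae_all_iff.2 fun j => tendsto_empMean_ae hindep hident
      ((hf i).mul (hf j)) ((hf2 i).integrable_mul (hf2 j))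
  filter_upwards [h1, h2] with ω hω1 hω2
  refine tendsto_pi_nhds.2 fun i => tendsto_pi_nhds.2 fun j => ?_
  have hcov : covMatrix P (X 0) f i j = ∫ ω, f i (X 0 ω) * f j (X 0 ω) ∂P -
      (∫ ω, f i (X 0 ω) ∂P) * ∫ ω, f j (X 0 ω) ∂P :=
    covariance_eq_sub (hf2 i) (hf2 j)
  rw [hcov]
  refine ((hω2 i j).sub ((hω1 i).mul (hω1 j))).congr' ?_
  filter_upwards [eventually_ne_atTop 0] with N hN
  exact (empCov_zero_eq hN _ _ ω).symm

/-- From `y² ≤ 1 + y⁴`. -/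
lemma memLp_two_of_integrable_pow_four {Y : Ω → ℝ} (hY : AEStronglyMeasurable Y P)
    (h : Integrable (fun ω => Y ω ^ 4) P) : MemLp Y 2 P := by
  refine (memLp_two_iff_integrable_sq hY).2
    (((integrable_const 1).add h).mono' (hY.pow 2) (ae_of_all _ fun ω => ?_))
  simp only [Pi.add_apply, Real.norm_eq_abs, abs_of_nonneg (sq_nonneg (Y ω))]
  nlinarith [sq_nonneg (Y ω ^ 2 - 1), sq_nonneg (Y ω)]

end Consistency

/-! ### The two limit theorems. -/

theorem theorem5 {Ω : Type*} [MeasurableSpace Ω] (P : Measure Ω) [IsProbabilityMeasure P]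
    (X : ℕ → Ω → ℝ) (hindep : iIndepFun X P) (hident : ∀ n, IdentDistrib (X n) (X 0) P P)
    (m K : ℕ) (f : Fin m → ℝ → ℝ) (hf : ∀ i, Measurable (f i))
    (hf4 : ∀ i, Integrable (fun ω => f i (X 0 ω) ^ 4) P)
    (hQ : (IIDTest.covMatrix P (X 0) f).PosDef)
    (Φ : Matrix (Fin m) (Fin m) ℝ → Matrix (Fin m) (Fin m) ℝ)
    (hΦmeas : Measurable[borel _, borel _] Φ)
    (hΦcont : ContinuousOn Φ {A | A.PosDef})
    (hΦ : ∀ A : Matrix (Fin m) (Fin m) ℝ, A.PosDef → (Φ A).transpose * Φ A = A⁻¹) :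
    TendstoInDistribution
      (fun N ω => IIDTest.whiten K N (Φ (IIDTest.empCovMatrix X N f ω))
        (fun k => IIDTest.empCovVec X N k f ω))
      atTop (fun x : EuclideanSpace ℝ (Fin K × Fin m × Fin m) => x)
      (fun _ => P) (multivariateGaussian 0 1) ∧
    TendstoInDistribution
      (fun N ω => IIDTest.whiten K N (Φ (IIDTest.empCorrMatrix X N f ω))
        (fun k => IIDTest.empCorrVec X N k f ω))
      atTop (fun x : EuclideanSpace ℝ (Fin K × Fin m × Fin m) => x)
      (fun _ => P) (multivariateGaussian 0 1) := by
  have hX : ∀ n, AEMeasurable (X n) P := fun n => (hident n).aemeasurable_fst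
  have hf2 : ∀ i, MemLp (fun ω => f i (X 0 ω)) 2 P := fun i =>
    memLp_two_of_integrable_pow_four ((hf i).comp_aemeasurable (hX 0)).aestronglyMeasurable (hf4 i)
  have hcons := tendsto_empCovMatrix_ae hindep hident hf hf2
  have hΦm : ∀ {A : Ω → Matrix (Fin m) (Fin m) ℝ}, (∀ i j, AEMeasurable (fun ω => A ω i j) P) →
      ∀ i j, AEMeasurable (fun ω => Φ (A ω) i j) P := by
    intro A hA i j
    -- The Borel σ-algebra on matrices is the product one, so measurability can be checked
    -- entrywise.
    have hborel : borel (Matrix (Fin m) (Fin m) ℝ) =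
        (inferInstance : MeasurableSpace (Fin m → Fin m → ℝ)) :=
      (BorelSpace.measurable_eq (α := Fin m → Fin m → ℝ)).symm
    rw [hborel] at hΦmeas
    have hA' : AEMeasurable (β := Fin m → Fin m → ℝ) A P :=
      aemeasurable_pi_lambda _ fun i => aemeasurable_pi_lambda _ fun j => hA i j
    have := Measurable.comp_aemeasurable (β := Fin m → Fin m → ℝ) (δ := Fin m → Fin m → ℝ)
      hΦmeas hA'
    exact aemeasurable_pi_iff.1 (aemeasurable_pi_iff.1 this i) j
  have hcovm : ∀ N i j, AEMeasurable (fun ω => IIDTest.empCovMatrix X N f ω i j) P :=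
    fun N i j => aemeasurable_empCov hX (hf i) (hf j) N 0
  have hstdm : ∀ N i, AEMeasurable (fun ω => (IIDTest.empStd X N (f i) ω)⁻¹) P :=
    fun N i => (aemeasurable_empStd hX (hf i) N).inv
  constructor
  · refine tendstoInDistribution_whiten hindep hident hf hf2 hQ (hΦ _ hQ)
      (fun N => hΦm (hcovm N)) ?_
    filter_upwards [hcons] with ω hω
    exact tendsto_comp_of_posSemidef hΦcont (fun N => posSemidef_empCovMatrix X N f ω) hQ hω
  · simp only [whiten_empCorrVec]
    let Q := IIDTest.covMatrix P (X 0) f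
    let D : Matrix (Fin m) (Fin m) ℝ := Matrix.diagonal fun i => (√(Q i i))⁻¹
    have hpos : ∀ i, 0 < √(Q i i) := fun i => Real.sqrt_pos.2 hQ.diag_pos
    have hDdet : IsUnit D.det := by
      rw [Matrix.det_diagonal, isUnit_iff_ne_zero]
      exact Finset.prod_ne_zero_iff.2 fun i _ => (inv_pos.2 (hpos i)).ne'
    have hQdet : IsUnit Q.det := (Matrix.isUnit_iff_isUnit_det _).1 hQ.isUnit
    have hDT : D.transpose = D := Matrix.diagonal_transpose _
    have hC : (D * Q * D).PosDef := by
      have h := hQ.posSemidef.mul_mul_conjTranspose_same D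
      rw [Matrix.conjTranspose_eq_transpose_of_trivial, hDT] at h
      refine h.posDef_iff_det_ne_zero.2 ?_
      rw [Matrix.det_mul, Matrix.det_mul]
      exact mul_ne_zero (mul_ne_zero hDdet.ne_zero hQdet.ne_zero) hDdet.ne_zero
    -- `D (D Q D)⁻¹ D = Q⁻¹`: a square root for the correlation matrix, rescaled by `D`, is one for
    -- the covariance matrix.
    have hB₀ : (Φ (D * Q * D) * D).transpose * (Φ (D * Q * D) * D) = Q⁻¹ := by
      rw [Matrix.transpose_mul, hDT, Matrix.mul_assoc, ← Matrix.mul_assoc _ _ D, hΦ _ hC,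
        Matrix.mul_inv_rev, Matrix.mul_inv_rev, ← Matrix.mul_assoc, ← Matrix.mul_assoc,
        Matrix.mul_nonsing_inv _ hDdet, Matrix.one_mul, Matrix.mul_assoc,
        Matrix.nonsing_inv_mul _ hDdet, Matrix.mul_one]
    refine tendstoInDistribution_whiten hindep hident hf hf2 hQ hB₀ (fun N i j => ?_) ?_
    · simp only [Matrix.mul_diagonal]
      refine (hΦm (fun i j => ?_) i j).mul (hstdm N j)
      simp only [empCorrMatrix_eq, Matrix.mul_diagonal, Matrix.diagonal_mul]
      exact ((hstdm N i).mul (hcovm N i j)).mul (hstdm N j)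
    · filter_upwards [hcons] with ω hω
      have hentry : ∀ i, Tendsto (fun N => (IIDTest.empStd X N (f i) ω)⁻¹) atTop
          (nhds (√(Q i i))⁻¹) := fun i => by
        simp only [empStd_eq_sqrt]
        exact (((Real.continuous_sqrt.tendsto _).comp
          (tendsto_pi_nhds.1 (tendsto_pi_nhds.1 hω i) i))).inv₀ (hpos i).ne'
      have hD : Tendsto (fun N => Matrix.diagonal fun i => (IIDTest.empStd X N (f i) ω)⁻¹) atTop
          (nhds D) :=
        ((continuous_id.matrix_diagonal).tendsto _).comp (tendsto_pi_nhds.2 hentry)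
      have hcorr : Tendsto (fun N => IIDTest.empCorrMatrix X N f ω) atTop
          (nhds (D * Q * D)) := by
        simp only [empCorrMatrix_eq]
        exact (hD.mul hω).mul hD
      exact (tendsto_comp_of_posSemidef hΦcont (fun N => posSemidef_empCorrMatrix X N f ω) hC
        hcorr).mul hD
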